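/- **Finite additivity of the rectangular finite $R$-transform.** Let $1\le d\le m$ be integers and $\lambda=d/m\in(0,1]$. Let $\operatorname{lc}(p)$ denote the leading coefficient of a polynomial $p$. *Convolution.* An $m\times d$ real matrix $A$ represents a real polynomial $p$ if $p(x)=\operatorname{lc}(p)\det(xI_d-A^{T}A)$; every real polynomial of degree $d$ with only nonnegative real roots is represented by some $A$. For two such polynomials $p,q$, represented by $A,B$, the $\lambda$-rectangular additive convolution is $$[p\boxplus_{d,\lambda}q](x)=\operatorname{lc}(p)\operatorname{lc}(q)\iint_{\mathcal O_m\times\mathcal O_d}\det\!\big(xI_d-(A+QBR)^{T}(A+QBR)\big)\,dR\,dQ,$$ where $dQ$, $dR$ are the Haar probability measures on the orthogonal groups. *$T$-transform.* For a real polynomial $p$ of degree $d$, a $T$-transform of $p$ is a multiset $\{t_1,\dots,t_d\}$ of complex numbers with $$\operatorname{lc}(p)\,\frac1d\sum_{i=1}^{d}e^{-t_i\,\partial_x\partial_y}\{y^{m}x^{d}\}=y^{m-d}p(xy).$$ Write $T_p$ for a random variable uniformly distributed on this multiset. *$R$-transform.* The rectangular finite $R$-transform $\mathcal R^{d,\lambda}_{\mathbb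 Sp}(s)$, where $\mathbb Sp(x)=p(x^2)$, is the unique real polynomial of degree at most $d$ such that, as formal power series in $s$, $$\mathcal R^{d,\lambda}_{\mathbb Sp}(s)\equiv-\frac1d\,s\,\frac{d}{ds}\log\mathbb E\big[e^{-T_p\,s\,m\,d}\big]\pmod{s^{d+1}}.$$ *Theorem.* Let $p,q$ be real polynomials of degree $d$ with only nonnegative real roots. Then $p\boxplus_{d,\lambda}q$ does not depend on the choice of the representing matrices, the $R$-transforms of $p$, $q$ and $p\boxplus_{d,\lambda}q$ exist and are unique, and $$\mathcal R^{d,\lambda}_{\mathbb S[p\boxplus_{d,\lambda}q]}(s)=\mathcal R^{d,\lambda}_{\mathbb Sp}(s)+\mathcal R^{d,\lambda}_{\mathbb Sq}(s).$$ -/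

import Mathlib

namespace RectFree

open Matrix MeasureTheory

/-! ### Haar measure on the orthogonal group -/

/-- The orthogonal group `O_n` of real `n × n` matrices. -/
abbrev Orth (n : ℕ) : Type := Matrix.orthogonalGroup (Fin n) ℝ

instance orthCompactSpace (n : ℕ) : CompactSpace (Orth n) := by
  suffices h : IsCompact ((Matrix.orthogonalGroup (Fin n) ℝ :
      Submonoid (Matrix (Fin n) (Fin n) ℝ)) : Set (Matrix (Fin n) (Fin n) ℝ)) from
    isCompact_iff_compactSpace.mp h
  have hK : IsCompact (Set.univ.pi fun _ : Fin n => Set.univ.pi fun _ : Fin n =>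
      Metric.closedBall (0 : ℝ) 1) :=
    isCompact_univ_pi fun _ => isCompact_univ_pi fun _ => isCompact_closedBall _ _
  refine hK.of_isClosed_subset ?_ ?_
  · have h : ((Matrix.orthogonalGroup (Fin n) ℝ : Submonoid (Matrix (Fin n) (Fin n) ℝ)) :
        Set (Matrix (Fin n) (Fin n) ℝ)) = {A | A * Aᵀ = 1} := by
      ext A
      exact Matrix.mem_orthogonalGroup_iff (Fin n) ℝ
    rw [h]
    exact isClosed_eq (by fun_prop) continuous_const
  · intro A hA i _ j _
    simpa using entry_norm_bound_of_unitary hA i j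

instance orthMeasurableSpace (n : ℕ) : MeasurableSpace (Orth n) := borel _

instance orthBorelSpace (n : ℕ) : BorelSpace (Orth n) := ⟨rfl⟩

/-- The Haar probability measure on `O_n`. -/
noncomputable def orthHaar (n : ℕ) : Measure (Orth n) := Measure.haarMeasure ⊤

/-! ### The rectangular additive convolution -/

/-- The characteristic polynomial `det (x I_d - Aᵀ A)` of the squared singular values of the
`m × d` matrix `A`. -/
noncomputable def singPoly {m d : ℕ} (A : Matrix (Fin m) (Fin d) ℝ) : Polynomial ℝ :=
  (Aᵀ * A).charpoly

/-- The average `∬ det (x I_d - (A + Q B R)ᵀ (A + Q B R)) dQ dR` over Haar distributed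
`Q ∈ O_m`, `R ∈ O_d`: a polynomial in `x` of degree `d`, integrated coefficient by coefficient. -/
noncomputable def haarAverage {m d : ℕ} (A B : Matrix (Fin m) (Fin d) ℝ) : Polynomial ℝ :=
  ∑ k ∈ Finset.range (d + 1), Polynomial.monomial k
    (∫ Q : Orth m, ∫ R : Orth d,
      (singPoly (A + (Q : Matrix (Fin m) (Fin m) ℝ) * B * (R : Matrix (Fin d) (Fin d) ℝ))).coeff k
      ∂(orthHaar d) ∂(orthHaar m))

/-- `A` represents `p`: the polynomial `p` is, up to its leading coefficient, the
characteristic polynomial of `Aᵀ A`. -/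
def Represents {m d : ℕ} (A : Matrix (Fin m) (Fin d) ℝ) (p : Polynomial ℝ) : Prop :=
  p = Polynomial.C p.leadingCoeff * singPoly A

open Classical in
/-- The rectangular additive convolution `p ⊞_{d,λ} q`, where `λ = d / m`: for representing
`m × d` matrices `A`, `B` of `p`, `q` it is the Haar average of `A` and `B` (extended
bilinearly to polynomials that are not monic). -/
noncomputable def rectConv (m d : ℕ) (p q : Polynomial ℝ) : Polynomial ℝ :=
  if h : (∃ A : Matrix (Fin m) (Fin d) ℝ, Represents A p) ∧
      (∃ B : Matrix (Fin m) (Fin d) ℝ, Represents B q) then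
    Polynomial.C (p.leadingCoeff * q.leadingCoeff) * haarAverage h.1.choose h.2.choose
  else 0

/-! ### The rectangular `T`-transform -/

/-- Polynomials in two variables `x = X 0` and `y = X 1`. -/
abbrev Biv : Type := MvPolynomial (Fin 2) ℂ

/-- The operator `∂_x ∂_y`. -/
noncomputable def dxdy (f : Biv) : Biv := MvPolynomial.pderiv 0 (MvPolynomial.pderiv 1 f)

/-- `e^{-t ∂_x ∂_y} f`. The exponential series stops by itself: `∂_x ∂_y` lowers the total
degree, so the terms of order larger than the total degree of `f` vanish. -/
noncomputable def expDxDy (t : ℂ) (f : Biv) : Biv :=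
  ∑ k ∈ Finset.range (f.totalDegree + 1),
    MvPolynomial.C ((-t) ^ k / (k.factorial : ℂ)) * dxdy^[k] f

/-- `T` is a rectangular `T`-transform of `p`: it is a multiset of `d` complex numbers such that
`(1/d) ∑_{t ∈ T} e^{-t ∂_x ∂_y} {y^m x^d} = y^{m-d} p(xy)`, where `p` is normalized to be monic
(here both sides are multiplied by the leading coefficient of `p`). -/
def IsTTransform (m d : ℕ) (p : Polynomial ℝ) (T : Multiset ℂ) : Prop :=
  T.card = d ∧
    MvPolynomial.C (p.leadingCoeff : ℂ) * (MvPolynomial.C (1 / (d : ℂ)) *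
      (T.map fun t => expDxDy t (MvPolynomial.X 1 ^ m * MvPolynomial.X 0 ^ d)).sum) =
    (MvPolynomial.X 1 ^ (m - d) *
      Polynomial.aeval (MvPolynomial.X 0 * MvPolynomial.X 1 : Biv) p : Biv)

/-! ### The rectangular finite `R`-transform -/

/-- The formal power series `E[e^{-T s m d}]` in `s`, where `T` is uniform on the given
multiset of `d` complex numbers. -/
noncomputable def expectExp (m d : ℕ) (T : Multiset ℂ) : PowerSeries ℂ :=
  PowerSeries.C (1 / (d : ℂ)) *
    (T.map fun t => PowerSeries.rescale (-t * (m : ℂ) * (d : ℂ)) (PowerSeries.exp ℂ)).sum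

/-- `R` is a rectangular finite `R`-transform of `p`: a real polynomial of degree at most `d`
with `R(s) ≡ -(1/d) s (d/ds) log E[e^{-T s m d}]` modulo `s^{d+1}`, with `T` the `T`-transform
of `p`. -/
def IsRTransform (m d : ℕ) (p R : Polynomial ℝ) : Prop :=
  R.natDegree ≤ d ∧ ∃ T : Multiset ℂ, IsTTransform m d p T ∧
    PowerSeries.trunc (d + 1) ((R.map Complex.ofRealHom : Polynomial ℂ) : PowerSeries ℂ) =
    PowerSeries.trunc (d + 1) (PowerSeries.C (-1 / (d : ℂ)) * PowerSeries.X *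
      PowerSeries.derivative ℂ (PowerSeries.logOf (expectExp m d T)))

open Classical in
/-- The rectangular finite `R`-transform `R^{d,λ}_{Sp}`, where `λ = d / m`. -/
noncomputable def rTransform (m d : ℕ) (p : Polynomial ℝ) : Polynomial ℝ :=
  if h : ∃ R : Polynomial ℝ, IsRTransform m d p R then h.choose else 0

/-- The polynomial `p` has degree `d` and only nonnegative real roots. -/
structure HasNonnegRoots (d : ℕ) (p : Polynomial ℝ) : Prop where
  natDegree_eq : p.natDegree = d
  splits : p.Splits
  roots_nonneg : ∀ x ∈ p.roots, 0 ≤ x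

end RectFree

/-! Write `singPoly A` as the sum of a_k x^(d-k) and `singPoly B` as the sum of b_k x^(d-k). The
heart of the matter is a closed formula: the coefficient of x^(d-k) in the Haar average is the sum
over i + j = k of (m-i choose j)(d-i choose j) / ((m choose j)(d choose j)) a_i b_j (`convCoeff`).

For signed permutation matrices in place of Haar matrices this is finite combinatorics. By a Schur
complement, det(xI - CᵀC) is the determinant of the block matrix with blocks 1, C, Cᵀ, xI, hence a
sum of principal minors. Averaging over signs keeps only products of minors of A and B on disjoint
index sets, and averaging over permutations makes the minors of B depend only on their size
(`sum_signed_singPoly`). The finite average is the same for every rotated pair Q B, A R⁻¹, so left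
invariance of Haar measure transfers its value to the integral
(`integral_orthHaar_of_sum_translates`, `haarAverage_coeff`). In particular only the characteristic
polynomials of AᵀA and BᵀB matter, which gives independence of the representing matrices.

After division by the falling factorials (m)_k (d)_k the formula becomes a plain Cauchy product
(`convCoeff_div`). These normalized coefficients are exactly (-1)^k E[T^k]/k!, so E[e^{-Tsmd}] is
multiplicative under the convolution modulo s^(d+1), and s (d/ds) log turns the product into a sum
(`rPoly_eq_add`). A transform T exists because d complex numbers can have any prescribed first d
power sums; different T agree on all moments of order at most d, so R is unique. -/

namespace RectFree

open Matrix MeasureTheory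

/-! ### Principal minors -/

section Minors

variable {ι R : Type*} [DecidableEq ι] [CommRing R]

/-- The matrix with diagonal blocks `M` on `S` and `N` on the complement of `S`. -/
def blockMix (S : Finset ι) (M N : Matrix ι ι R) : Matrix ι ι R :=
  of fun i j => if i ∈ S then (if j ∈ S then M i j else 0) else (if j ∈ S then 0 else N i j)

/-- The principal minor of `M` with rows and columns in `S`. -/
def pminor (M : Matrix ι ι R) (S : Finset ι) : R :=
  (M.submatrix ((↑) : S → ι) ((↑) : S → ι)).det

theorem pminor_congr {M N : Matrix ι ι R} {S : Finset ι}
    (h : ∀ i ∈ S, ∀ j ∈ S, M i j = N i j) : pminor M S = pminor N S := by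
  unfold pminor
  congr 1
  ext i j
  exact h i i.2 j j.2

theorem pminor_diagonal (z : ι → R) (S : Finset ι) :
    pminor (diagonal z) S = ∏ i ∈ S, z i := by
  rw [pminor, submatrix_diagonal _ _ Subtype.val_injective, det_diagonal]
  exact Finset.prod_coe_sort S z

theorem pminor_eq_zero_of_row {M : Matrix ι ι R} {S : Finset ι} {i : ι} (hi : i ∈ S)
    (h : ∀ j ∈ S, M i j = 0) : pminor M S = 0 :=
  det_eq_zero_of_row_eq_zero ⟨i, hi⟩ fun j => h j j.2

theorem pminor_map {R' : Type*} [CommRing R'] (f : R →+* R') (M : Matrix ι ι R) (S : Finset ι) :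
    pminor (M.map f) S = f (pminor M S) := by
  rw [pminor, pminor, RingHom.map_det]
  rfl

theorem pminor_submatrix_equiv (M : Matrix ι ι R) (e : Equiv.Perm ι) (S : Finset ι) :
    pminor (M.submatrix e e) S = pminor M (S.map e.toEmbedding) := by
  have h : ∀ i, i ∈ S ↔ e i ∈ S.map e.toEmbedding := by simp
  rw [pminor, pminor, ← det_submatrix_equiv_self (e.subtypeEquiv h)]
  rfl

theorem pminor_mul_mul (u v : ι → R) (M : Matrix ι ι R) (S : Finset ι) :
    pminor (of fun i j => u i * M i j * v j) S = (∏ i ∈ S, u i) * (∏ i ∈ S, v i) * pminor M S := by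
  rw [← Finset.prod_coe_sort S u, ← Finset.prod_coe_sort S v, mul_assoc, pminor, pminor,
    ← det_mul_row, ← det_mul_column]
  congr 1
  ext i j
  simp only [submatrix_apply, of_apply]
  ring

variable [Fintype ι]

theorem det_eq_pminor_mul_pminor_compl (M : Matrix ι ι R) (S : Finset ι)
    (h : ∀ i, i ∉ S → ∀ j, j ∈ S → M i j = 0) :
    M.det = pminor M S * pminor M Sᶜ := by
  rw [twoBlockTriangular_det M (fun i => i ∈ S) h, pminor, pminor]
  refine congrArg₂ _ (by rw [toSquareBlockProp_def]; congr!) ?_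
  rw [← det_submatrix_equiv_self (Equiv.subtypeEquivRight (by simp) : {i // i ∉ S} ≃ {i // i ∈ Sᶜ})]
  rfl

theorem det_blockMix (S : Finset ι) (M N : Matrix ι ι R) :
    (blockMix S M N).det = pminor M S * pminor N Sᶜ := by
  rw [det_eq_pminor_mul_pminor_compl _ S]
  · congr 1 <;> refine pminor_congr fun i hi j hj => ?_
    · simp [blockMix, hi, hj]
    · simp_all [blockMix]
  · intro i hi j hj
    simp [blockMix, hi, hj]

/-- Expansion of `det (diag z + M)` in principal minors. -/
theorem det_diagonal_add (z : ι → R) (M : Matrix ι ι R) :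
    (diagonal z + M).det = ∑ S : Finset ι, (∏ i ∈ Sᶜ, z i) * pminor M S := by
  rw [add_comm]
  have h := (detRowAlternating (n := ι) (R := R)).map_add_univ M (diagonal z)
  refine h.trans (Finset.sum_congr rfl fun S _ => ?_)
  have key (K : Matrix ι ι R) (h1 : ∀ i ∈ S, ∀ j, K i j = M i j)
      (h2 : ∀ i ∉ S, ∀ j, K i j = diagonal z i j) :
      K.det = (∏ i ∈ Sᶜ, z i) * pminor M S := by
    rw [det_eq_pminor_mul_pminor_compl _ S, mul_comm, ← pminor_diagonal]
    · congr 1 <;> refine pminor_congr fun i hi j hj => ?_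
      · exact h2 i (by simpa using hi) j
      · exact h1 i hi j
    · intro i hi j hj
      rw [h2 i hi, diagonal_apply_ne]
      rintro rfl
      exact hi hj
  exact key _ (fun i hi j => congrFun (Finset.piecewise_eq_of_mem _ _ _ hi) j)
    (fun i hi j => congrFun (Finset.piecewise_eq_of_notMem _ _ _ hi) j)

theorem pminor_diagonal_add (z : ι → R) (M : Matrix ι ι R) (S : Finset ι) :
    pminor (diagonal z + M) S = ∑ T ∈ S.powerset, (∏ i ∈ S \ T, z i) * pminor M T := by
  -- Padding by the identity outside `S` turns the minor into a full determinant, to which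
  -- `det_diagonal_add` applies. Index sets not contained in `S` then contain a zero row of
  -- `blockMix S M 0`.
  have h1 : pminor (diagonal z + M) S = (blockMix S (diagonal z + M) 1).det := by
    rw [det_blockMix, ← diagonal_one, pminor_diagonal]; simp
  have h2 : blockMix S (diagonal z + M) 1 =
      diagonal (fun i => if i ∈ S then z i else 1) + blockMix S M 0 := by
    ext i j
    by_cases hi : i ∈ S <;> by_cases hj : j ∈ S <;> by_cases hij : i = j <;>
      simp_all [blockMix, diagonal_apply, one_apply]
  rw [h1, h2, det_diagonal_add, ← Finset.sum_subset (Finset.subset_univ S.powerset)]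
  · refine Finset.sum_congr rfl fun T hT => ?_
    rw [Finset.mem_powerset] at hT
    congr 1
    · rw [Finset.prod_ite, Finset.prod_const_one, mul_one]
      refine Finset.prod_congr ?_ fun _ _ => rfl
      ext i; simp [and_comm]
    · refine pminor_congr fun i hi j hj => ?_
      simp [blockMix, hT hi, hT hj]
  · intro T _ hT
    rw [Finset.mem_powerset, Finset.not_subset] at hT
    obtain ⟨i, hiT, hiS⟩ := hT
    rw [pminor_eq_zero_of_row hiT, mul_zero]
    intro j _
    simp [blockMix, hiS]

/-- Orthogonality of sign characters: after reindexing by σ, the sign ε i occurs once for i ∉ S and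
once for σ i ∉ S. The sum over ε i vanishes when exactly one of these holds, and is 2 otherwise. -/
theorem sum_signs_prod (S : Finset ι) (σ : Equiv.Perm ι) :
    ∑ ε : ι → ℤˣ, ∏ i, (if σ i ∈ S then (1 : R) else ((ε (σ i) : ℤ) : R) * ((ε i : ℤ) : R)) =
      if ∀ i, i ∈ S ↔ σ i ∈ S then 2 ^ Fintype.card ι else 0 := by
  have h1 (ε : ι → ℤˣ) :
      ∏ i, (if σ i ∈ S then (1 : R) else ((ε (σ i) : ℤ) : R) * ((ε i : ℤ) : R)) =
      ∏ i, ((if i ∈ S then (1 : R) else ((ε i : ℤ) : R)) *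
        (if σ i ∈ S then 1 else ((ε i : ℤ) : R))) := by
    rw [Finset.prod_mul_distrib,
      ← Equiv.prod_comp σ (fun i => if i ∈ S then (1 : R) else ((ε i : ℤ) : R)),
      ← Finset.prod_mul_distrib]
    refine Finset.prod_congr rfl fun i _ => ?_
    split_ifs <;> simp
  simp only [h1]
  rw [← Fintype.piFinset_univ, ← Finset.prod_univ_sum (fun _ : ι => (Finset.univ : Finset ℤˣ))
    (fun i e => (if i ∈ S then (1 : R) else ((e : ℤ) : R)) * (if σ i ∈ S then 1 else ((e : ℤ) : R)))]
  split_ifs with h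
  · rw [← Finset.card_univ, ← Finset.prod_const]
    refine Finset.prod_congr rfl fun i _ => ?_
    have := h i
    by_cases hi : i ∈ S
    · simp [hi, this.1 hi, one_add_one_eq_two]
    · simp [hi, mt this.2 hi, ← Int.cast_mul, one_add_one_eq_two]
  · push Not at h
    obtain ⟨i, hi⟩ := h
    refine Finset.prod_eq_zero (Finset.mem_univ i) ?_
    rcases hi with ⟨h1, h2⟩ | ⟨h1, h2⟩ <;> simp [h1, h2]

/-- Averaging over conjugations of `N` by diagonal sign matrices leaves only products of
complementary principal minors. -/
theorem sum_signs_det (M N : Matrix ι ι R) :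
    ∑ ε : ι → ℤˣ, (M + of fun i j => ((ε i : ℤ) : R) * ((ε j : ℤ) : R) * N i j).det =
      2 ^ Fintype.card ι * ∑ S : Finset ι, pminor M S * pminor N Sᶜ := by
  have h (ε : ι → ℤˣ) : (M + of fun i j => ((ε i : ℤ) : R) * ((ε j : ℤ) : R) * N i j).det =
      ∑ S : Finset ι, ∑ σ : Equiv.Perm ι, ((Equiv.Perm.sign σ : ℤ) : R) *
        ((∏ i, if σ i ∈ S then M (σ i) i else N (σ i) i) *
        ∏ i, (if σ i ∈ S then (1 : R) else ((ε (σ i) : ℤ) : R) * ((ε i : ℤ) : R))) := by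
    refine ((detRowAlternating (n := ι) (R := R)).map_add_univ M _).trans
      (Finset.sum_congr rfl fun S _ => ?_)
    refine (det_apply' _).trans (Finset.sum_congr rfl fun σ _ => ?_)
    rw [← Finset.prod_mul_distrib]
    congr 1
    refine Finset.prod_congr rfl fun i _ => ?_
    by_cases hi : σ i ∈ S <;> simp [Finset.piecewise, hi]
    ring
  simp only [h]
  rw [Finset.sum_comm, Finset.mul_sum]
  refine Finset.sum_congr rfl fun S _ => ?_
  rw [Finset.sum_comm, ← det_blockMix, det_apply', Finset.mul_sum]
  refine Finset.sum_congr rfl fun σ _ => ?_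
  rw [← Finset.mul_sum, ← Finset.mul_sum, sum_signs_prod]
  split_ifs with hσ
  · have : ∏ i, blockMix S M N (σ i) i = ∏ i, if σ i ∈ S then M (σ i) i else N (σ i) i := by
      refine Finset.prod_congr rfl fun i _ => ?_
      simp only [blockMix, of_apply, hσ i]
      split_ifs <;> rfl
    rw [this]; ring
  · push Not at hσ
    obtain ⟨i, hi⟩ := hσ
    rw [Finset.prod_eq_zero (f := fun i => blockMix S M N (σ i) i) (Finset.mem_univ i)]
    · simp
    · rcases hi with ⟨h1, h2⟩ | ⟨h1, h2⟩ <;> simp [blockMix, h1, h2]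

end Minors

/-! ### Minors of rectangular matrices -/

section Rect

variable {α β R : Type*} [DecidableEq α] [DecidableEq β] [CommRing R]

/-- The symmetric matrix with off-diagonal blocks `C` and `Cᵀ`. -/
def symMat (C : Matrix α β R) : Matrix (α ⊕ β) (α ⊕ β) R := fromBlocks 0 C Cᵀ 0

/-- The principal minor of `symMat C` with rows and columns in `U ⊔ V`. -/
def rminor (C : Matrix α β R) (U : Finset α) (V : Finset β) : R :=
  pminor (symMat C) (U.disjSum V)

/-- Scaling the `α` rows by 2 and the `β` columns by 1/2 leaves `symMat C` unchanged, yet multiplies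
the minor by 2^(|U| - |V|). -/
theorem rminor_eq_zero {α β : Type*} [DecidableEq α] [DecidableEq β] (C : Matrix α β ℝ)
    {U : Finset α} {V : Finset β} (h : U.card ≠ V.card) : rminor C U V = 0 := by
  have h1 : symMat C = of fun i j => (Sum.elim (fun _ => 2) (fun _ => 1) i : ℝ) * symMat C i j *
      (Sum.elim (fun _ => 1) (fun _ => 1 / 2) j : ℝ) := by
    ext (i | i) (j | j) <;> simp [symMat]
    ring
  have h2 : rminor C U V = (2 : ℝ) ^ U.card * (1 / 2) ^ V.card * rminor C U V := by
    conv_lhs => rw [rminor, h1, pminor_mul_mul]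
    simp [Finset.prod_disjSum, rminor]
  have h3 : (2 : ℝ) ^ U.card * (1 / 2) ^ V.card ≠ 1 := by
    intro h4
    rw [one_div, inv_pow, mul_inv_eq_one₀ (by positivity)] at h4
    exact h (pow_right_injective₀ (by norm_num) (by norm_num) h4)
  by_contra h4
  exact h3 (mul_right_cancel₀ h4 (by rw [← h2, one_mul]))

theorem rminor_submatrix_equiv (C : Matrix α β R) (e : Equiv.Perm α) (f : Equiv.Perm β)
    (U : Finset α) (V : Finset β) :
    rminor (C.submatrix e f) U V = rminor C (U.map e.toEmbedding) (V.map f.toEmbedding) := by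
  have h : symMat (C.submatrix e f) =
      (symMat C).submatrix (Equiv.Perm.sumCongr e f) (Equiv.Perm.sumCongr e f) := by
    ext (i | i) (j | j) <;> simp [symMat]
  rw [rminor, rminor, h, pminor_submatrix_equiv]
  congr 1
  ext (i | i) <;> simp

theorem sum_finset_sum {α β M : Type*} [AddCommMonoid M] [Fintype α] [Fintype β]
    (f : Finset (α ⊕ β) → M) :
    ∑ S, f S = ∑ U : Finset α, ∑ V : Finset β, f (U.disjSum V) := by
  rw [← Fintype.sum_prod_type', ← Equiv.sum_comp Finset.sumEquiv.symm.toEquiv]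
  rfl

theorem compl_disjSum [Fintype α] [Fintype β] (U : Finset α) (V : Finset β) :
    (U.disjSum V)ᶜ = Uᶜ.disjSum Vᶜ := by
  ext (i | i) <;> simp

theorem sum_powerset_disjSum {α β M : Type*} [AddCommMonoid M]
    (U : Finset α) (V : Finset β) (f : Finset (α ⊕ β) → M) :
    ∑ S ∈ (U.disjSum V).powerset, f S =
      ∑ U' ∈ U.powerset, ∑ V' ∈ V.powerset, f (U'.disjSum V') := by
  rw [← Finset.sum_product']
  refine (Finset.sum_bij' (fun (p : Finset α × Finset β) _ => p.1.disjSum p.2)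
    (fun S _ => (S.toLeft, S.toRight)) ?_ ?_ ?_ ?_ ?_).symm
  · rintro ⟨a, b⟩ h
    simp only [Finset.mem_product, Finset.mem_powerset] at h ⊢
    exact Finset.disjSum_mono h.1 h.2
  · intro S h
    simp only [Finset.mem_product, Finset.mem_powerset] at h ⊢
    refine ⟨fun x hx => ?_, fun x hx => ?_⟩
    · simpa using h (Finset.mem_toLeft.1 hx)
    · simpa using h (Finset.mem_toRight.1 hx)
  · rintro ⟨a, b⟩ _
    simp
  · intro S _
    exact Finset.toLeft_disjSum_toRight
  · rintro ⟨a, b⟩ _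
    rfl

end Rect

/-! ### Characteristic polynomials of squared singular values as sums of principal minors. -/

section Average

open Polynomial

variable {m d : ℕ}

/-- Schur complement of the identity block. The point of the larger matrix is that it is linear in
C, whereas CᵀC is quadratic. -/
theorem singPoly_eq_det (C : Matrix (Fin m) (Fin d) ℝ) :
    singPoly C = (diagonal (Sum.elim (fun _ => 1) (fun _ => X)) +
      (symMat C).map Polynomial.C : Matrix (Fin m ⊕ Fin d) (Fin m ⊕ Fin d) ℝ[X]).det := by
  have h : (diagonal (Sum.elim (fun _ => 1) (fun _ => X)) + (symMat C).map Polynomial.C :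
      Matrix (Fin m ⊕ Fin d) (Fin m ⊕ Fin d) ℝ[X]) =
      fromBlocks 1 (C.map Polynomial.C) (Cᵀ.map Polynomial.C) (scalar _ X) := by
    ext1 i j
    rcases i with i | i <;> rcases j with j | j <;>
      simp [symMat, diagonal_apply, one_apply]
  rw [h, det_fromBlocks_one₁₁, singPoly, charpoly, charmatrix, ← Matrix.map_mul]
  rfl

theorem singPoly_eq_sum (C : Matrix (Fin m) (Fin d) ℝ) :
    singPoly C = ∑ U : Finset (Fin m), ∑ V : Finset (Fin d),
      X ^ (d - V.card) * Polynomial.C (rminor C U V) := by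
  rw [singPoly_eq_det, det_diagonal_add, sum_finset_sum]
  refine Finset.sum_congr rfl fun U _ => Finset.sum_congr rfl fun V _ => ?_
  rw [pminor_map, compl_disjSum, Finset.prod_disjSum]
  simp [Finset.card_compl, rminor]

/-- The sum of the squared `k × k` minors of `C`, up to sign. -/
noncomputable def minorSum (C : Matrix (Fin m) (Fin d) ℝ) (a b : ℕ) : ℝ :=
  ∑ U ∈ Finset.univ.powersetCard a, ∑ V ∈ Finset.univ.powersetCard b, rminor C U V

theorem minorSum_of_ne (C : Matrix (Fin m) (Fin d) ℝ) {a b : ℕ} (h : a ≠ b) :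
    minorSum C a b = 0 :=
  Finset.sum_eq_zero fun U hU => Finset.sum_eq_zero fun V hV => rminor_eq_zero C (by
    rw [(Finset.mem_powersetCard.1 hU).2, (Finset.mem_powersetCard.1 hV).2]; exact h)

theorem sum_univ_finset_eq_range {M : Type*} [AddCommMonoid M] (n : ℕ) (f : Finset (Fin n) → M) :
    ∑ U, f U = ∑ k ∈ Finset.range (n + 1), ∑ U ∈ Finset.univ.powersetCard k, f U := by
  have h := Finset.sum_powerset (Finset.univ : Finset (Fin n)) f
  simpa using h

theorem sum_rminor_mul {M : Type*} [AddCommGroup M] [Module ℝ M] (hdm : d ≤ m)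
    (C : Matrix (Fin m) (Fin d) ℝ) (f : ℕ → ℕ → M) :
    ∑ U : Finset (Fin m), ∑ V : Finset (Fin d), rminor C U V • f U.card V.card =
      ∑ k ∈ Finset.range (d + 1), minorSum C k k • f k k := by
  have h : ∑ U : Finset (Fin m), ∑ V : Finset (Fin d), rminor C U V • f U.card V.card =
      ∑ a ∈ Finset.range (m + 1), ∑ b ∈ Finset.range (d + 1), minorSum C a b • f a b := by
    rw [sum_univ_finset_eq_range]
    refine Finset.sum_congr rfl fun a _ => ?_
    have h' (b : ℕ) : minorSum C a b • f a b = ∑ U ∈ Finset.univ.powersetCard a,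
        ∑ V ∈ Finset.univ.powersetCard b, rminor C U V • f a b := by
      simp_rw [minorSum, Finset.sum_smul]
    simp_rw [h']
    rw [Finset.sum_comm (s := Finset.range (d + 1))]
    refine Finset.sum_congr rfl fun U hU => ?_
    rw [sum_univ_finset_eq_range]
    refine Finset.sum_congr rfl fun b _ => Finset.sum_congr rfl fun V hV => ?_
    rw [(Finset.mem_powersetCard.1 hU).2, (Finset.mem_powersetCard.1 hV).2]
  rw [h, Finset.sum_comm]
  refine Finset.sum_congr rfl fun b hb => ?_
  rw [Finset.mem_range] at hb
  refine Finset.sum_eq_single_of_mem b (Finset.mem_range.2 (by lia)) fun a _ hab => ?_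
  rw [minorSum_of_ne C hab, zero_smul]

theorem singPoly_eq_sum_minorSum (hdm : d ≤ m) (C : Matrix (Fin m) (Fin d) ℝ) :
    singPoly C = ∑ k ∈ Finset.range (d + 1), minorSum C k k • (X : ℝ[X]) ^ (d - k) := by
  rw [singPoly_eq_sum, ← sum_rminor_mul hdm C (fun _ b => (X : ℝ[X]) ^ (d - b))]
  refine Finset.sum_congr rfl fun U _ => Finset.sum_congr rfl fun V _ => ?_
  rw [smul_eq_C_mul, mul_comm]

theorem coeff_sum_smul_X_pow (a : ℕ → ℝ) {k : ℕ} (hk : k ≤ d) :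
    (∑ i ∈ Finset.range (d + 1), a i • (X : ℝ[X]) ^ (d - i)).coeff (d - k) = a k := by
  rw [finsetSum_coeff, Finset.sum_eq_single_of_mem k (Finset.mem_range.2 (by lia))]
  · simp
  · intro i hi hik
    rw [Finset.mem_range] at hi
    rw [coeff_smul, coeff_X_pow, if_neg (by lia), smul_zero]

theorem minorSum_eq_coeff (hdm : d ≤ m) (C : Matrix (Fin m) (Fin d) ℝ) {k : ℕ} (hk : k ≤ d) :
    minorSum C k k = (singPoly C).coeff (d - k) := by
  rw [singPoly_eq_sum_minorSum hdm, coeff_sum_smul_X_pow (fun k => minorSum C k k) hk]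

/-- Double counting over pairs (π, W): permutations act transitively on sets of a given size, so the
sum over π is the same for every W; for fixed π the sets W are merely permuted among themselves. -/
theorem sum_perm_map (n : ℕ) (f : Finset (Fin n) → ℝ) (U : Finset (Fin n)) :
    (n.choose U.card : ℝ) * ∑ π : Equiv.Perm (Fin n), f (U.map π.toEmbedding) =
      n.factorial * ∑ W ∈ Finset.univ.powersetCard U.card, f W := by
  have hconst : ∀ W ∈ Finset.univ.powersetCard U.card,
      ∑ π : Equiv.Perm (Fin n), f (W.map π.toEmbedding) =
        ∑ π : Equiv.Perm (Fin n), f (U.map π.toEmbedding) := by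
    intro W hW
    rw [Finset.mem_powersetCard] at hW
    obtain ⟨τ, hτ⟩ : ∃ τ : Equiv.Perm (Fin n), ∀ x, x ∈ U ↔ τ x ∈ W := by
      have e : {x // x ∈ U} ≃ {x // x ∈ W} := Finset.equivOfCardEq hW.2.symm
      refine ⟨e.extendSubtype, fun x => ⟨fun h => ?_, fun h => ?_⟩⟩
      · exact e.extendSubtype_mem x h
      · by_contra hx
        exact e.extendSubtype_not_mem x hx h
    have hW' : W = U.map τ.toEmbedding := by
      ext x
      rw [Finset.mem_map_equiv, hτ, Equiv.apply_symm_apply]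
    rw [hW', ← Equiv.sum_comp (Equiv.mulRight τ)
      (fun π : Equiv.Perm (Fin n) => f (U.map π.toEmbedding))]
    refine Finset.sum_congr rfl fun π _ => ?_
    rw [Finset.map_map]
    rfl
  have h1 := Finset.sum_congr (rfl : (Finset.univ : Finset (Fin n)).powersetCard U.card = _) hconst
  rw [Finset.sum_const, Finset.card_powersetCard, Finset.card_univ, Fintype.card_fin,
    nsmul_eq_mul] at h1
  rw [← h1, Finset.sum_comm]
  have h2 (π : Equiv.Perm (Fin n)) :
      ∑ W ∈ Finset.univ.powersetCard U.card, f (W.map π.toEmbedding) =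
        ∑ W ∈ Finset.univ.powersetCard U.card, f W := by
    refine Finset.sum_bij' (fun W _ => W.map π.toEmbedding) (fun W _ => W.map π.symm.toEmbedding)
      ?_ ?_ ?_ ?_ ?_
    · intro W hW
      simpa using hW
    · intro W hW
      simpa using hW
    · intro W _
      ext x; simp
    · intro W _
      ext x; simp
    · intro W _
      rfl
  simp [h2, Fintype.card_perm]

theorem sum_perm_rminor (B : Matrix (Fin m) (Fin d) ℝ) (U : Finset (Fin m))
    (V : Finset (Fin d)) :
    ∑ π : Equiv.Perm (Fin m), ∑ ρ : Equiv.Perm (Fin d), rminor (B.submatrix π ρ) U V =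
      m.factorial * d.factorial *
        (minorSum B U.card V.card / (m.choose U.card * d.choose V.card)) := by
  have hU : (m.choose U.card : ℝ) ≠ 0 := by
    have := Nat.choose_pos (card_finset_fin_le U); positivity
  have hV : (d.choose V.card : ℝ) ≠ 0 := by
    have := Nat.choose_pos (card_finset_fin_le V); positivity
  rw [← mul_div_assoc, eq_div_iff (mul_ne_zero hU hV)]
  simp_rw [rminor_submatrix_equiv]
  have h1 (W : Finset (Fin m)) := sum_perm_map d (fun V' => rminor B W V') V
  have h2 := sum_perm_map m
    (fun W => ∑ V' ∈ Finset.univ.powersetCard V.card, rminor B W V') U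
  calc _ = (m.choose U.card : ℝ) * ∑ π : Equiv.Perm (Fin m), ((d.choose V.card : ℝ) *
      ∑ ρ : Equiv.Perm (Fin d), rminor B (U.map π.toEmbedding) (V.map ρ.toEmbedding)) := by
        rw [← Finset.mul_sum]; ring
    _ = _ := by
        simp_rw [h1]
        rw [← Finset.mul_sum, mul_left_comm, h2, minorSum]
        ring

end Average

/-! ### Averages over sign changes. -/

section SignAverage

variable {ι R : Type*} [Fintype ι] [DecidableEq ι] [CommRing R]

/-- Every index goes to a minor of `M` (set T), to a minor of `N` (set S), or to a diagonal entry
`z`; the two sets are disjoint. -/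
theorem sum_signs_det_diagonal_add (z : ι → R) (M N : Matrix ι ι R) :
    ∑ ε : ι → ℤˣ,
      (diagonal z + M + of fun i j => ((ε i : ℤ) : R) * ((ε j : ℤ) : R) * N i j).det =
      2 ^ Fintype.card ι * ∑ T : Finset ι, ∑ S ∈ Tᶜ.powerset,
        (∏ i ∈ Sᶜ \ T, z i) * (pminor M T * pminor N S) := by
  rw [sum_signs_det, ← Equiv.sum_comp (compl_involutive.toPerm (compl : Finset ι → Finset ι))]
  congr 1
  simp only [Function.Involutive.coe_toPerm, compl_compl, pminor_diagonal_add, Finset.sum_mul,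
    mul_assoc]
  refine Finset.sum_comm' fun S T => ?_
  simp only [Finset.mem_powerset, Finset.mem_univ, true_and, and_true]
  exact le_compl_comm

end SignAverage

/-! ### Averages over signed permutations and the coefficient formula. -/

section Average

open Polynomial

variable {m d : ℕ}

/-- `B` with permuted rows and columns, multiplied by signs. -/
def signedSubmatrix (ε : Fin m → ℤˣ) (δ : Fin d → ℤˣ) (π : Equiv.Perm (Fin m))
    (ρ : Equiv.Perm (Fin d)) (B : Matrix (Fin m) (Fin d) ℝ) : Matrix (Fin m) (Fin d) ℝ :=
  of fun i j => ((ε i : ℤ) : ℝ) * ((δ j : ℤ) : ℝ) * B (π i) (ρ j)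

theorem sum_signs_singPoly (A B : Matrix (Fin m) (Fin d) ℝ) (π : Equiv.Perm (Fin m))
    (ρ : Equiv.Perm (Fin d)) :
    ∑ ε : Fin m → ℤˣ, ∑ δ : Fin d → ℤˣ, singPoly (A + signedSubmatrix ε δ π ρ B) =
      (2 : ℝ) ^ (m + d) • ∑ U : Finset (Fin m), ∑ V : Finset (Fin d), rminor A U V •
        ∑ U' ∈ Uᶜ.powerset, ∑ V' ∈ Vᶜ.powerset,
          rminor (B.submatrix π ρ) U' V' • (X : ℝ[X]) ^ (d - V.card - V'.card) := by
  -- Row signs and column signs together form one sign vector η on the disjoint union, and they act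
  -- on `symMat` by diagonal conjugation.
  have h (η : Fin m ⊕ Fin d → ℤˣ) :
      (diagonal (Sum.elim (fun _ => 1) (fun _ => X)) + (symMat (A +
        signedSubmatrix (fun i => η (.inl i)) (fun i => η (.inr i)) π ρ B)).map Polynomial.C :
        Matrix (Fin m ⊕ Fin d) (Fin m ⊕ Fin d) ℝ[X]) =
      diagonal (Sum.elim (fun _ => 1) (fun _ => X)) + (symMat A).map Polynomial.C +
        of fun i j => ((η i : ℤ) : ℝ[X]) * ((η j : ℤ) : ℝ[X]) *
          ((symMat (B.submatrix π ρ)).map Polynomial.C) i j := by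
    rw [add_assoc]
    congr 1
    ext1 i j
    rcases i with i | i <;> rcases j with j | j <;>
      simp [symMat, signedSubmatrix, mul_comm]
  rw [← Fintype.sum_prod_type', ← Equiv.sum_comp (Equiv.sumArrowEquivProdArrow _ _ _)]
  simp only [singPoly_eq_det]
  refine (Finset.sum_congr rfl (fun η _ => congrArg Matrix.det (h η))).trans ?_
  rw [sum_signs_det_diagonal_add,
    sum_finset_sum, smul_eq_C_mul]
  refine congrArg₂ (· * ·)
    (by rw [Fintype.card_sum, Fintype.card_fin, Fintype.card_fin, map_pow, map_ofNat]) ?_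
  refine Finset.sum_congr rfl fun U _ => Finset.sum_congr rfl fun V _ => ?_
  rw [compl_disjSum, sum_powerset_disjSum, Finset.smul_sum]
  refine Finset.sum_congr rfl fun U' hU' => ?_
  rw [Finset.smul_sum]
  refine Finset.sum_congr rfl fun V' hV' => ?_
  rw [Finset.mem_powerset] at hU' hV'
  have hs : (U'.disjSum V')ᶜ \ U.disjSum V = (U'ᶜ \ U).disjSum (V'ᶜ \ V) := by
    ext (i | i) <;> simp
  have hc : (V'ᶜ \ V).card = d - V.card - V'.card := by
    rw [Finset.card_sdiff_of_subset (le_compl_comm.1 hV'),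
      Finset.card_compl, Fintype.card_fin]
    lia
  rw [hs, Finset.prod_disjSum, pminor_map, pminor_map]
  simp only [Sum.elim_inl, Sum.elim_inr, Finset.prod_const_one, Finset.prod_const, one_mul, hc,
    smul_eq_C_mul, rminor]
  ring

/-- The binomials (m-i choose j) and (d-i choose j) count the sets U' and V' of size j that avoid
given U and V of size i; the denominators come from the permutation average `sum_perm_rminor`. -/
theorem sum_signed_singPoly (hdm : d ≤ m) (A B : Matrix (Fin m) (Fin d) ℝ) :
    ∑ π : Equiv.Perm (Fin m), ∑ ρ : Equiv.Perm (Fin d), ∑ ε : Fin m → ℤˣ, ∑ δ : Fin d → ℤˣ,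
      singPoly (A + signedSubmatrix ε δ π ρ B) =
      ((2 : ℝ) ^ (m + d) * (m.factorial * d.factorial)) • ∑ i ∈ Finset.range (d + 1),
        minorSum A i i • ∑ j ∈ Finset.range (d - i + 1),
          (((m - i).choose j * (d - i).choose j : ℝ) / (m.choose j * d.choose j) *
            minorSum B j j) • (X : ℝ[X]) ^ (d - i - j) := by
  set g : ℕ → ℕ → ℝ := fun a b => minorSum B a b / (m.choose a * d.choose b) with hg
  have h1 (U : Finset (Fin m)) (V : Finset (Fin d)) :
      ∑ U' ∈ Uᶜ.powerset, ∑ V' ∈ Vᶜ.powerset,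
        g U'.card V'.card • (X : ℝ[X]) ^ (d - V.card - V'.card) =
      ∑ j ∈ Finset.range (d - V.card + 1), ∑ a ∈ Finset.range (m - U.card + 1),
        (((m - U.card).choose a * (d - V.card).choose j : ℝ) * g a j) •
          (X : ℝ[X]) ^ (d - V.card - j) := by
    rw [Finset.sum_powerset_apply_card (fun a => ∑ V' ∈ Vᶜ.powerset,
        g a V'.card • (X : ℝ[X]) ^ (d - V.card - V'.card)), Finset.sum_comm (s := Finset.range _),
        Finset.card_compl, Fintype.card_fin]
    refine Finset.sum_congr rfl fun a _ => ?_
    rw [Finset.sum_powerset_apply_card (fun b => g a b • (X : ℝ[X]) ^ (d - V.card - b)),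
      Finset.card_compl, Fintype.card_fin, Finset.smul_sum]
    refine Finset.sum_congr rfl fun b _ => ?_
    rw [← Nat.cast_smul_eq_nsmul ℝ, ← Nat.cast_smul_eq_nsmul ℝ, smul_smul, smul_smul, mul_assoc]
  have h2 : ∑ π : Equiv.Perm (Fin m), ∑ ρ : Equiv.Perm (Fin d), ∑ ε : Fin m → ℤˣ,
      ∑ δ : Fin d → ℤˣ, singPoly (A + signedSubmatrix ε δ π ρ B) =
      ((2 : ℝ) ^ (m + d) * (m.factorial * d.factorial)) •
        ∑ U : Finset (Fin m), ∑ V : Finset (Fin d), rminor A U V •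
        ∑ U' ∈ Uᶜ.powerset, ∑ V' ∈ Vᶜ.powerset,
          g U'.card V'.card • (X : ℝ[X]) ^ (d - V.card - V'.card) := by
    simp_rw [sum_signs_singPoly, ← Finset.smul_sum]
    rw [mul_smul]
    congr 1
    simp_rw [Finset.smul_sum]
    rw [← Fintype.sum_prod_type', Finset.sum_comm]
    refine Finset.sum_congr rfl fun U _ => ?_
    rw [Finset.sum_comm]
    refine Finset.sum_congr rfl fun V _ => ?_
    rw [Finset.sum_comm]
    refine Finset.sum_congr rfl fun U' _ => ?_
    rw [Finset.sum_comm]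
    refine Finset.sum_congr rfl fun V' _ => ?_
    rw [Fintype.sum_prod_type]
    simp_rw [← Finset.smul_sum, ← Finset.sum_smul]
    rw [sum_perm_rminor, smul_comm (rminor A U V), smul_smul]
    rw [smul_smul, smul_smul]
    congr 1
    simp only [hg]
    ring
  rw [h2]
  congr 1
  simp_rw [h1]
  rw [sum_rminor_mul hdm A (fun u v => ∑ j ∈ Finset.range (d - v + 1),
    ∑ a ∈ Finset.range (m - u + 1), (((m - u).choose a * (d - v).choose j : ℝ) * g a j) •
          (X : ℝ[X]) ^ (d - v - j))]
  refine Finset.sum_congr rfl fun i hi => ?_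
  congr 1
  refine Finset.sum_congr rfl fun j hj => ?_
  rw [Finset.mem_range] at hi hj
  -- Nonsquare minors vanish, so only a = j contributes.
  rw [Finset.sum_eq_single_of_mem j (Finset.mem_range.2 (by lia))]
  · rw [hg]
    congr 1
    ring
  · intro a _ haj
    simp [hg, minorSum_of_ne B haj]

/-- The coefficients of the rectangular convolution of monic polynomials. -/
noncomputable def convCoeff (m d : ℕ) (a b : ℕ → ℝ) (k : ℕ) : ℝ :=
  ∑ ij ∈ Finset.HasAntidiagonal.antidiagonal k,
    ((m - ij.1).choose ij.2 * (d - ij.1).choose ij.2 : ℝ) / (m.choose ij.2 * d.choose ij.2) *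
      (a ij.1 * b ij.2)

theorem sum_signed_coeff (hdm : d ≤ m) (A B : Matrix (Fin m) (Fin d) ℝ) {k : ℕ} (hk : k ≤ d) :
    ∑ π : Equiv.Perm (Fin m), ∑ ρ : Equiv.Perm (Fin d), ∑ ε : Fin m → ℤˣ, ∑ δ : Fin d → ℤˣ,
      (singPoly (A + signedSubmatrix ε δ π ρ B)).coeff (d - k) =
      ((2 : ℝ) ^ (m + d) * (m.factorial * d.factorial)) *
        convCoeff m d (fun i => (singPoly A).coeff (d - i)) (fun j => (singPoly B).coeff (d - j))
          k := by
  have h := congrArg (fun p => p.coeff (d - k)) (sum_signed_singPoly hdm A B)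
  simp only [finsetSum_coeff, coeff_smul, smul_eq_mul] at h
  rw [h, convCoeff, Finset.Nat.sum_antidiagonal_eq_sum_range_succ_mk]
  congr 1
  -- Since i + j ≤ d, the truncated exponent d - i - j is exact; it equals d - k only for j = k - i,
  -- and never for i > k.
  rw [← Finset.sum_subset (Finset.range_mono (Nat.succ_le_succ hk))]
  · refine Finset.sum_congr rfl fun i hi => ?_
    rw [Finset.mem_range] at hi
    rw [Finset.sum_eq_single_of_mem (k - i) (Finset.mem_range.2 (by lia)),
      minorSum_eq_coeff hdm A (by lia), minorSum_eq_coeff hdm B (by lia), coeff_X_pow,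
      if_pos (by lia)]
    · ring
    · intro j hj hjk
      rw [Finset.mem_range] at hj
      rw [coeff_X_pow, if_neg (by lia), mul_zero]
  · intro i hi hik
    rw [Finset.mem_range] at hi hik
    rw [Finset.sum_eq_zero, mul_zero]
    intro j hj
    rw [Finset.mem_range] at hj
    rw [coeff_X_pow, if_neg (by lia), mul_zero]

end Average

/-! ### From signed permutations to Haar measure. -/

section Haar

open Polynomial

variable {m d : ℕ}

instance orthHaar_isProbabilityMeasure (n : ℕ) : IsProbabilityMeasure (orthHaar n) :=
  ⟨Measure.haarMeasure_self⟩

instance orthHaar_isMulLeftInvariant (n : ℕ) : (orthHaar n).IsMulLeftInvariant :=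
  inferInstanceAs (Measure.haarMeasure ⊤).IsMulLeftInvariant

/-- The orthogonal matrix of the signed permutation `e_j ↦ ε_i e_i`, `π i = j`. -/
def signedPerm {n : ℕ} (ε : Fin n → ℤˣ) (π : Equiv.Perm (Fin n)) : Orth n :=
  ⟨of fun i j => if π i = j then ((ε i : ℤ) : ℝ) else 0, by
    rw [mem_orthogonalGroup_iff]
    ext i j
    have h : ((ε i : ℤ) : ℝ) * ((ε i : ℤ) : ℝ) = 1 := by
      rw [← Int.cast_mul, Int.units_coe_mul_self, Int.cast_one]
    by_cases hij : i = j
    · subst hij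
      simp [mul_apply, h]
    · simp [mul_apply, hij, one_apply]⟩

theorem signedPerm_mul_mul (ε : Fin m → ℤˣ) (δ : Fin d → ℤˣ) (π : Equiv.Perm (Fin m))
    (ρ : Equiv.Perm (Fin d)) (B : Matrix (Fin m) (Fin d) ℝ) :
    (signedPerm ε π : Matrix (Fin m) (Fin m) ℝ) * B * (signedPerm δ ρ : Matrix (Fin d) (Fin d) ℝ)ᵀ =
      signedSubmatrix ε δ π ρ B := by
  ext i j
  have h1 : (signedPerm ε π : Matrix (Fin m) (Fin m) ℝ) =
      of fun i j => if π i = j then ((ε i : ℤ) : ℝ) else 0 := rfl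
  have h2 : (signedPerm δ ρ : Matrix (Fin d) (Fin d) ℝ) =
      of fun i j => if ρ i = j then ((δ i : ℤ) : ℝ) else 0 := rfl
  rw [Matrix.mul_assoc, Matrix.mul_apply, Finset.sum_eq_single_of_mem (π i) (Finset.mem_univ _),
    Matrix.mul_apply, Finset.sum_eq_single_of_mem (ρ j) (Finset.mem_univ _)]
  · simp [h1, h2, signedSubmatrix]
    ring
  · intro x _ hx
    simp [h2, hx.symm]
  · intro x _ hx
    simp [h1, hx.symm]

theorem singPoly_mul_left (Q : Orth m) (C : Matrix (Fin m) (Fin d) ℝ) :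
    singPoly ((Q : Matrix (Fin m) (Fin m) ℝ) * C) = singPoly C := by
  have h : (Q : Matrix (Fin m) (Fin m) ℝ)ᵀ * (Q : Matrix (Fin m) (Fin m) ℝ) = 1 := (mem_orthogonalGroup_iff' _ _).1 Q.2
  rw [singPoly, singPoly, transpose_mul, Matrix.mul_assoc, ← Matrix.mul_assoc _ _ C, h,
    Matrix.one_mul]

theorem singPoly_mul_right (C : Matrix (Fin m) (Fin d) ℝ) (R : Orth d) :
    singPoly (C * (R : Matrix (Fin d) (Fin d) ℝ)) = singPoly C := by
  have h : (R : Matrix (Fin d) (Fin d) ℝ) * (R : Matrix (Fin d) (Fin d) ℝ)ᵀ = 1 := (mem_orthogonalGroup_iff _ _).1 R.2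
  rw [singPoly, singPoly, transpose_mul, Matrix.mul_assoc, charpoly_mul_comm, Matrix.mul_assoc,
    Matrix.mul_assoc, h, Matrix.mul_one]

/-- The coefficients are values of fixed polynomials, those of the universal characteristic
polynomial, at the entries of CᵀC. -/
theorem continuous_singPoly_coeff (k : ℕ) :
    Continuous fun C : Matrix (Fin m) (Fin d) ℝ => (singPoly C).coeff k := by
  have h (C : Matrix (Fin m) (Fin d) ℝ) : (singPoly C).coeff k =
      MvPolynomial.eval (fun ij : Fin d × Fin d => (Cᵀ * C) ij.1 ij.2)
        ((charpoly.univ ℝ (Fin d)).coeff k) := by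
    exact (charpoly.univ_coeff_eval₂Hom (Fin d) (RingHom.id ℝ)
      (fun ij : Fin d × Fin d => (Cᵀ * C) ij.1 ij.2) k).symm
  simp only [h]
  refine (MvPolynomial.continuous_eval _).comp (continuous_pi fun ij => ?_)
  exact Continuous.matrix_elem (by fun_prop) ij.1 ij.2

theorem continuous_coeff_rotation (A B : Matrix (Fin m) (Fin d) ℝ) (k : ℕ) :
    Continuous fun p : Orth m × Orth d => (singPoly (A + (p.1 : Matrix (Fin m) (Fin m) ℝ) * B *
      (p.2 : Matrix (Fin d) (Fin d) ℝ))).coeff k := by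
  refine (continuous_singPoly_coeff k).comp ?_
  fun_prop

/-- Multiplying on the right by R⁻¹ moves R onto A, and Q is absorbed into B. Neither changes the
singular values, so the finite average does not depend on Q and R. -/
theorem sum_coeff_signedPerm_mul (hdm : d ≤ m) (A B : Matrix (Fin m) (Fin d) ℝ) {k : ℕ}
    (hk : k ≤ d) (Q : Orth m) (R : Orth d) :
    ∑ π : Equiv.Perm (Fin m), ∑ ρ : Equiv.Perm (Fin d), ∑ ε : Fin m → ℤˣ, ∑ δ : Fin d → ℤˣ,
      (singPoly (A + ((signedPerm ε π * Q : Orth m) : Matrix (Fin m) (Fin m) ℝ) * B *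
        (((signedPerm δ ρ)⁻¹ * R : Orth d) : Matrix (Fin d) (Fin d) ℝ))).coeff (d - k) =
      ((2 : ℝ) ^ (m + d) * (m.factorial * d.factorial)) *
        convCoeff m d (fun i => (singPoly A).coeff (d - i)) (fun j => (singPoly B).coeff (d - j))
          k := by
  have h := sum_signed_coeff hdm (A * ((R⁻¹ : Orth d) : Matrix (Fin d) (Fin d) ℝ))
    ((Q : Matrix (Fin m) (Fin m) ℝ) * B) hk
  rw [singPoly_mul_right, singPoly_mul_left] at h
  rw [← h]
  refine Finset.sum_congr rfl fun π _ => Finset.sum_congr rfl fun ρ _ =>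
    Finset.sum_congr rfl fun ε _ => Finset.sum_congr rfl fun δ _ => ?_
  rw [← signedPerm_mul_mul, ← singPoly_mul_right (_ + _ * _ * _ᵀ) R, Matrix.add_mul]
  have h1 : A * ((R⁻¹ : Orth d) : Matrix (Fin d) (Fin d) ℝ) * (R : Matrix (Fin d) (Fin d) ℝ) =
      A := by
    rw [Matrix.mul_assoc, ← Submonoid.coe_mul, inv_mul_cancel, Submonoid.coe_one, Matrix.mul_one]
  have h2 : (((signedPerm δ ρ)⁻¹ : Orth d) : Matrix (Fin d) (Fin d) ℝ) =
      (signedPerm δ ρ : Matrix (Fin d) (Fin d) ℝ)ᵀ := rfl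
  rw [h1, Submonoid.coe_mul, Submonoid.coe_mul, h2]
  simp only [Matrix.mul_assoc]

/-- A function whose average over finitely many left translates is constant has that constant
as its Haar integral. -/
theorem integral_orthHaar_of_sum_translates {κ : Type*} [Fintype κ] [Nonempty κ]
    {f : Orth m → Orth d → ℝ} (hf : Continuous (Function.uncurry f))
    (P : κ → Orth m) (P' : κ → Orth d) (c : ℝ)
    (hsum : ∀ Q R, ∑ i, f (P i * Q) (P' i * R) = Fintype.card κ * c) :
    ∫ Q, ∫ R, f Q R ∂(orthHaar d) ∂(orthHaar m) = c := by
  have hint {n : ℕ} {g : Orth n → ℝ} (hg : Continuous g) : Integrable g (orthHaar n) :=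
    hg.integrable_of_hasCompactSupport (HasCompactSupport.of_compactSpace g)
  have hcont (i : κ) : Continuous (Function.uncurry fun Q R => f (P i * Q) (P' i * R)) := by
    have h : Continuous fun p : Orth m × Orth d => (P i * p.1, P' i * p.2) := by fun_prop
    exact hf.comp h
  have hinner (i : κ) (Q : Orth m) :
      Integrable (fun R => f (P i * Q) (P' i * R)) (orthHaar d) := by
    have h : Continuous fun R : Orth d => (Q, R) := by fun_prop
    exact hint ((hcont i).comp h)
  have houter (i : κ) :
      Integrable (fun Q => ∫ R, f (P i * Q) (P' i * R) ∂(orthHaar d)) (orthHaar m) := by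
    -- First countability is needed for the continuity of the inner integral as a function of Q.
    have : FirstCountableTopology (Matrix (Fin m) (Fin m) ℝ) :=
      inferInstanceAs (FirstCountableTopology (Fin m → Fin m → ℝ))
    have : FirstCountableTopology (Orth m) := Topology.IsInducing.subtypeVal.firstCountableTopology
    have h := continuous_parametric_integral_of_continuous (μ := orthHaar d) (s := Set.univ)
      (hcont i) isCompact_univ
    simp only [Measure.restrict_univ] at h
    exact hint h
  have hinv (i : κ) :
      ∫ Q, ∫ R, f (P i * Q) (P' i * R) ∂(orthHaar d) ∂(orthHaar m) =
        ∫ Q, ∫ R, f Q R ∂(orthHaar d) ∂(orthHaar m) := by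
    rw [integral_mul_left_eq_self (fun Q => ∫ R, f Q (P' i * R) ∂(orthHaar d)) (P i)]
    congr 1
    ext Q
    exact integral_mul_left_eq_self (fun R => f Q R) (P' i)
  have hN : (Fintype.card κ : ℝ) ≠ 0 := Nat.cast_ne_zero.2 Fintype.card_ne_zero
  refine mul_left_cancel₀ hN ?_
  calc _ = ∑ i, ∫ Q, ∫ R, f (P i * Q) (P' i * R) ∂(orthHaar d) ∂(orthHaar m) := by
        simp only [hinv, Finset.sum_const, Finset.card_univ, nsmul_eq_mul]
    _ = ∫ Q, ∫ R, ∑ i, f (P i * Q) (P' i * R) ∂(orthHaar d) ∂(orthHaar m) := by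
        rw [← integral_finsetSum _ fun i _ => houter i]
        congr 1
        ext Q
        rw [integral_finsetSum _ fun i _ => hinner i Q]
    _ = _ := by simp [hsum]

theorem integral_coeff_rotation (hdm : d ≤ m) (A B : Matrix (Fin m) (Fin d) ℝ) {k : ℕ}
    (hk : k ≤ d) :
    ∫ Q : Orth m, ∫ R : Orth d,
      (singPoly (A + (Q : Matrix (Fin m) (Fin m) ℝ) * B * (R : Matrix (Fin d) (Fin d) ℝ))).coeff
        (d - k) ∂(orthHaar d) ∂(orthHaar m) =
      convCoeff m d (fun i => (singPoly A).coeff (d - i)) (fun j => (singPoly B).coeff (d - j))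
          k := by
  refine integral_orthHaar_of_sum_translates
    (κ := (Equiv.Perm (Fin m) × Equiv.Perm (Fin d)) × ((Fin m → ℤˣ) × (Fin d → ℤˣ)))
    (continuous_coeff_rotation A B (d - k))
    (fun κ => signedPerm κ.2.1 κ.1.1) (fun κ => (signedPerm κ.2.2 κ.1.2)⁻¹) _ fun Q R => ?_
  rw [Fintype.sum_prod_type, Fintype.sum_prod_type]
  simp only [Fintype.sum_prod_type]
  rw [sum_coeff_signedPerm_mul hdm A B hk Q R]
  congr 1
  simp [Fintype.card_perm, pow_add]
  ring

theorem haarAverage_coeff (hdm : d ≤ m) (A B : Matrix (Fin m) (Fin d) ℝ) {k : ℕ} (hk : k ≤ d) :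
    (haarAverage A B).coeff (d - k) =
      convCoeff m d (fun i => (singPoly A).coeff (d - i)) (fun j => (singPoly B).coeff (d - j))
          k := by
  rw [← integral_coeff_rotation hdm A B hk, haarAverage, finsetSum_coeff,
    Finset.sum_eq_single_of_mem (d - k) (Finset.mem_range.2 (by lia))]
  · rw [coeff_monomial, if_pos rfl]
  · intro i _ hi
    rw [coeff_monomial, if_neg hi]

theorem haarAverage_natDegree_le (A B : Matrix (Fin m) (Fin d) ℝ) :
    (haarAverage A B).natDegree ≤ d := by
  refine natDegree_sum_le_of_forall_le _ _ fun i hi => (natDegree_monomial_le _).trans ?_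
  exact Nat.lt_succ_iff.1 (Finset.mem_range.1 hi)

end Haar

/-! ### Prescribed power sums -/

section Newton

/-- The elementary symmetric functions determined by power sums through Newton's identities. -/
noncomputable def newtonEsymm (s : ℕ → ℂ) : ℕ → ℂ
  | 0 => 1
  | k + 1 => (-1) ^ k / (k + 1 : ℂ) *
      ∑ i : Fin (k + 1), (-1) ^ (i : ℕ) * newtonEsymm s i * s (k + 1 - i)

theorem newtonEsymm_succ (s : ℕ → ℂ) (k : ℕ) :
    ((k + 1 : ℕ) : ℂ) * newtonEsymm s (k + 1) = (-1) ^ k *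
      ∑ i ∈ Finset.range (k + 1), (-1) ^ i * newtonEsymm s i * s (k + 1 - i) := by
  rw [newtonEsymm, Finset.sum_range]
  have : (k + 1 : ℂ) ≠ 0 := by exact_mod_cast Nat.succ_ne_zero k
  push_cast
  field_simp

theorem newton_identity {n : ℕ} (f : Fin n → ℂ) (k : ℕ) :
    ((k + 1 : ℕ) : ℂ) * (Finset.univ.val.map f).esymm (k + 1) = (-1) ^ k *
      ∑ i ∈ Finset.range (k + 1), (-1) ^ i * (Finset.univ.val.map f).esymm i *
        ∑ j, f j ^ (k + 1 - i) := by
  have h := congrArg (MvPolynomial.aeval f) (MvPolynomial.mul_esymm_eq_sum (Fin n) ℂ (k + 1))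
  simp only [map_mul, map_natCast, map_pow, map_neg, map_one, map_sum,
    MvPolynomial.aeval_esymm_eq_multiset_esymm, MvPolynomial.psum, MvPolynomial.aeval_X] at h
  rw [h, Finset.sum_filter, Finset.Nat.sum_antidiagonal_eq_sum_range_succ_mk,
    Finset.sum_range_succ]
  rw [if_neg (lt_irrefl _), add_zero, pow_succ (-1 : ℂ) (k + 1), pow_succ (-1 : ℂ) k]
  have : ∀ i ∈ Finset.range (k + 1), (if i < k + 1 then
      (-1) ^ i * (Finset.univ.val.map f).esymm i * ∑ j, f j ^ (k + 1 - i) else 0) =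
      (-1) ^ i * (Finset.univ.val.map f).esymm i * ∑ j, f j ^ (k + 1 - i) := fun i hi =>
    if_pos (Finset.mem_range.1 hi)
  simp only []
  rw [Finset.sum_congr rfl this]
  ring

-- T consists of the roots of the monic polynomial whose coefficients are the prescribed values with
-- alternating signs.
open Polynomial in
theorem exists_multiset_esymm (d : ℕ) (e : ℕ → ℂ) (he : e 0 = 1) :
    ∃ T : Multiset ℂ, T.card = d ∧ ∀ k ≤ d, T.esymm k = e k := by
  set f : ℂ[X] := ∑ k ∈ Finset.range (d + 1), ((-1) ^ k * e k) • (X : ℂ[X]) ^ (d - k) with hf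
  have hcoeff : ∀ k ≤ d, f.coeff (d - k) = (-1) ^ k * e k := by
    intro k hk
    rw [hf, finsetSum_coeff, Finset.sum_eq_single_of_mem k (Finset.mem_range.2 (by lia))]
    · simp
    · intro i hi hik
      rw [Finset.mem_range] at hi
      rw [coeff_smul, coeff_X_pow, if_neg (by lia), smul_zero]
  have hdeg : f.natDegree ≤ d :=
    natDegree_sum_le_of_forall_le _ _ fun i _ => (natDegree_smul_le _ _).trans
      ((natDegree_X_pow_le _).trans (Nat.sub_le _ _))
  have hlead : f.coeff d = 1 := by simpa [he] using hcoeff 0 (Nat.zero_le _)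
  have hnat : f.natDegree = d :=
    le_antisymm hdeg (le_natDegree_of_ne_zero (by rw [hlead]; exact one_ne_zero))
  have hcard : f.roots.card = f.natDegree := (IsAlgClosed.splits f).natDegree_eq_card_roots.symm
  refine ⟨f.roots, hcard.trans hnat, fun k hk => ?_⟩
  have h := coeff_eq_esymm_roots_of_card hcard (k := d - k) (by rw [hnat]; exact Nat.sub_le _ _)
  rw [hcoeff k hk, leadingCoeff, hnat, hlead, one_mul, Nat.sub_sub_self hk] at h
  exact (mul_left_cancel₀ (pow_ne_zero _ (by norm_num)) h).symm

theorem exists_eq_map_univ {α : Type*} {T : Multiset α} {n : ℕ} (hT : T.card = n) :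
    ∃ f : Fin n → α, T = Finset.univ.val.map f := by
  have h : n = T.toList.length := by rw [Multiset.length_toList, hT]
  subst h
  exact ⟨T.toList.get, by rw [Fin.univ_val_map, List.ofFn_get, Multiset.coe_toList]⟩

/-- The exponent 0 is excluded because the zeroth power sum is forced to be d. -/
theorem exists_multiset_power_sums (d : ℕ) (s : ℕ → ℂ) :
    ∃ T : Multiset ℂ, T.card = d ∧
      ∀ k, 0 < k → k ≤ d → (T.map fun t => t ^ k).sum = s k := by
  obtain ⟨T, hT, he⟩ := exists_multiset_esymm d (newtonEsymm s) (by rw [newtonEsymm])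
  refine ⟨T, hT, ?_⟩
  obtain ⟨f, rfl⟩ := exists_eq_map_univ hT
  intro k
  induction k using Nat.strong_induction_on with
  | _ k ih =>
    intro hk hkd
    obtain ⟨k, rfl⟩ := Nat.exists_eq_succ_of_ne_zero hk.ne'
    have h1 := newton_identity f k
    have h2 := newtonEsymm_succ s k
    rw [← he _ hkd, h1] at h2
    have h3 := mul_left_cancel₀ (pow_ne_zero _ (by norm_num)) h2
    -- The term i = 0 carries the power sum of order k + 1 with coefficient e_0 = 1; all other terms
    -- agree by induction, so it can be cancelled out.
    rw [Finset.sum_range_succ', Finset.sum_range_succ'] at h3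
    have h4 : ∀ i ∈ Finset.range k,
        (-1) ^ (i + 1) * (Finset.univ.val.map f).esymm (i + 1) *
          ∑ j, f j ^ (k + 1 - (i + 1)) =
        (-1) ^ (i + 1) * newtonEsymm s (i + 1) * s (k + 1 - (i + 1)) := by
      intro i hi
      rw [Finset.mem_range] at hi
      have h5 := ih (k + 1 - (i + 1)) (by lia) (by lia) (by lia)
      rw [Multiset.map_map] at h5
      rw [he _ (by lia), ← h5]
      rfl
    rw [Finset.sum_congr rfl h4] at h3
    have h5 := add_left_cancel h3
    rw [he 0 (Nat.zero_le _), newtonEsymm] at h5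
    have h6 : ∑ j, f j ^ (k + 1) = s (k + 1) := by simpa using h5
    rw [Multiset.map_map]
    exact h6

end Newton

/-! ### Moments of the T-transform -/

section TTransform

open MvPolynomial

theorem dxdy_iterate (m d k : ℕ) :
    dxdy^[k] (X 1 ^ m * X 0 ^ d : Biv) =
      C ((m.descFactorial k * d.descFactorial k : ℕ) : ℂ) * (X 1 ^ (m - k) * X 0 ^ (d - k)) := by
  induction k with
  | zero => simp
  | succ k ih =>
    rw [Function.iterate_succ_apply', ih, dxdy]
    have h01 : (1 : Fin 2) ≠ 0 := by decide
    simp only [Derivation.leibniz, Derivation.leibniz_pow, pderiv_C, pderiv_X_self,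
      pderiv_X_of_ne h01, pderiv_X_of_ne h01.symm, smul_eq_mul, nsmul_eq_mul, mul_zero, smul_zero,
      add_zero, zero_add, mul_one, Nat.descFactorial_succ, Derivation.map_natCast, Nat.sub_sub]
    push_cast
    simp only [map_mul, map_natCast]
    ring

theorem expDxDy_eq (m d : ℕ) (t : ℂ) :
    expDxDy t (X 1 ^ m * X 0 ^ d) = ∑ k ∈ Finset.range (d + 1),
      C (((m.descFactorial k * d.descFactorial k : ℕ) : ℂ) * ((-t) ^ k / (k.factorial : ℂ))) *
        (X 1 ^ (m - k) * X 0 ^ (d - k) : Biv) := by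
  have hdeg : (X 1 ^ m * X 0 ^ d : Biv).totalDegree = m + d := by
    rw [totalDegree_mul_of_isDomain (pow_ne_zero _ (X_ne_zero _)) (pow_ne_zero _ (X_ne_zero _)),
      totalDegree_X_pow, totalDegree_X_pow]
  -- The exponential is cut off at the total degree m + d, but the terms past d already vanish since
  -- (d)_k = 0.
  rw [expDxDy, hdeg, ← Finset.sum_subset (Finset.range_mono (by lia : d + 1 ≤ m + d + 1))]
  · refine Finset.sum_congr rfl fun k _ => ?_
    rw [dxdy_iterate, ← mul_assoc, ← C_mul, mul_comm (_ / _)]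
  · intro k _ hk
    rw [Finset.mem_range] at hk
    rw [dxdy_iterate, Nat.descFactorial_eq_zero_iff_lt.2 (by lia : d < k)]
    simp

theorem coeff_sum_C_mul (m d : ℕ) (a : ℕ → ℂ) {k : ℕ} (hk : k ≤ d) :
    (∑ i ∈ Finset.range (d + 1), C (a i) * (X 1 ^ (m - i) * X 0 ^ (d - i) : Biv)).coeff
      (Finsupp.single 1 (m - k) + Finsupp.single 0 (d - k)) = a k := by
  have h (i : ℕ) : (X 1 ^ (m - i) * X 0 ^ (d - i) : Biv) =
      monomial (Finsupp.single 1 (m - i) + Finsupp.single 0 (d - i)) 1 := by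
    rw [X_pow_eq_monomial, X_pow_eq_monomial, monomial_mul, one_mul]
  simp only [coeff_sum, coeff_C_mul, h, coeff_monomial]
  rw [Finset.sum_eq_single_of_mem k (Finset.mem_range.2 (by lia))]
  · simp
  · intro i hi hik
    rw [Finset.mem_range] at hi
    rw [if_neg, mul_zero]
    intro h
    have := DFunLike.congr_fun h 0
    simp at this
    lia

theorem aeval_mul_eq_sum {m d : ℕ} (hdm : d ≤ m) {p : Polynomial ℝ} (hp : p.natDegree ≤ d) :
    (X 1 ^ (m - d) * Polynomial.aeval (X 0 * X 1 : Biv) p : Biv) =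
      ∑ k ∈ Finset.range (d + 1), C ((p.coeff (d - k) : ℝ) : ℂ) *
        (X 1 ^ (m - k) * X 0 ^ (d - k) : Biv) := by
  rw [Polynomial.aeval_eq_sum_range' (Nat.lt_succ_of_le hp), ← Finset.sum_range_reflect,
    Finset.mul_sum]
  refine Finset.sum_congr rfl fun k hk => ?_
  rw [Finset.mem_range] at hk
  have h1 : d.succ - 1 - k = d - k := by lia
  have h2 : m - k = (m - d) + (d - k) := by lia
  rw [h1, h2, pow_add, mul_pow, Algebra.smul_def]
  have h3 : algebraMap ℝ Biv (p.coeff (d - k)) = C ((p.coeff (d - k) : ℝ) : ℂ) := rfl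
  rw [h3]
  ring

/-- Both sides are combinations of the distinct monomials y^(m-k) x^(d-k), so the identity is one
moment condition for each k ≤ d. -/
theorem isTTransform_iff {m d : ℕ} (hdm : d ≤ m) {p : Polynomial ℝ} (hp : p.natDegree ≤ d)
    (T : Multiset ℂ) :
    IsTTransform m d p T ↔ T.card = d ∧ ∀ k ≤ d,
      (p.leadingCoeff : ℂ) * (((m.descFactorial k * d.descFactorial k : ℕ) : ℂ) *
        (1 / (d : ℂ) * (T.map fun t => (-t) ^ k / (k.factorial : ℂ)).sum)) =
      ((p.coeff (d - k) : ℝ) : ℂ) := by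
  have hL : (C (p.leadingCoeff : ℂ) * (C (1 / (d : ℂ)) *
      (T.map fun t => expDxDy t (X 1 ^ m * X 0 ^ d)).sum) : Biv) =
      ∑ k ∈ Finset.range (d + 1), C ((p.leadingCoeff : ℂ) *
        (((m.descFactorial k * d.descFactorial k : ℕ) : ℂ) *
        (1 / (d : ℂ) * (T.map fun t => (-t) ^ k / (k.factorial : ℂ)).sum))) *
          (X 1 ^ (m - k) * X 0 ^ (d - k) : Biv) := by
    simp only [expDxDy_eq]
    have h : (T.map fun t => ∑ k ∈ Finset.range (d + 1),
        C (((m.descFactorial k * d.descFactorial k : ℕ) : ℂ) * ((-t) ^ k / (k.factorial : ℂ))) *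
          (X 1 ^ (m - k) * X 0 ^ (d - k) : Biv)).sum =
        ∑ k ∈ Finset.range (d + 1), C (((m.descFactorial k * d.descFactorial k : ℕ) : ℂ) *
          (T.map fun t => (-t) ^ k / (k.factorial : ℂ)).sum) *
            (X 1 ^ (m - k) * X 0 ^ (d - k) : Biv) := by
      rw [Multiset.sum_map_sum]
      refine Finset.sum_congr rfl fun k _ => ?_
      rw [Multiset.sum_map_mul_right, ← Multiset.sum_map_mul_left, map_multiset_sum,
        Multiset.map_map]
      rfl
    rw [h, Finset.mul_sum, Finset.mul_sum]
    refine Finset.sum_congr rfl fun k _ => ?_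
    simp only [map_mul]
    ring
  rw [IsTTransform, hL, aeval_mul_eq_sum hdm hp]
  refine and_congr_right fun _ => ⟨fun h k hk => ?_, fun h => ?_⟩
  · have h1 := congrArg (coeff (Finsupp.single 1 (m - k) + Finsupp.single 0 (d - k))) h
    rwa [coeff_sum_C_mul m d _ hk, coeff_sum_C_mul m d _ hk] at h1
  · refine Finset.sum_congr rfl fun k hk => ?_
    rw [h k (Nat.lt_succ_iff.1 (Finset.mem_range.1 hk))]

/-- The normalized coefficient `(-1)^k E[T^k] / k!` of a polynomial with `T`-transform `T`. -/
noncomputable def normCoeff (m d : ℕ) (p : Polynomial ℝ) (k : ℕ) : ℝ :=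
  p.coeff (d - k) / (p.leadingCoeff * (m.descFactorial k * d.descFactorial k))

/-- A real power series that agrees with `E[e^{-T s m d}]` up to order `d`. -/
noncomputable def momentSeries (m d : ℕ) (p : Polynomial ℝ) : PowerSeries ℝ :=
  PowerSeries.mk fun k => (m * d : ℝ) ^ k * normCoeff m d p k

theorem coeff_expectExp (m d : ℕ) (T : Multiset ℂ) (k : ℕ) :
    PowerSeries.coeff k (expectExp m d T) = (m * d : ℂ) ^ k *
      (1 / (d : ℂ) * (T.map fun t => (-t) ^ k / (k.factorial : ℂ)).sum) := by
  rw [expectExp, PowerSeries.coeff_C_mul, map_multiset_sum, Multiset.map_map, mul_left_comm]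
  refine congrArg (1 / (d : ℂ) * ·) ?_
  rw [← Multiset.sum_map_mul_left]
  refine congrArg Multiset.sum (Multiset.map_congr rfl fun t _ => ?_)
  simp only [Function.comp_apply, PowerSeries.coeff_rescale, PowerSeries.coeff_exp, map_div₀,
    map_one, map_natCast]
  rw [mul_pow, mul_pow, mul_pow]
  ring

theorem coeff_expectExp_of_isTTransform {m d : ℕ} (hdm : d ≤ m) {p : Polynomial ℝ}
    (hp : p.natDegree = d) (hp0 : p ≠ 0) {T : Multiset ℂ} (hT : IsTTransform m d p T) {k : ℕ}
    (hk : k ≤ d) :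
    PowerSeries.coeff k (expectExp m d T) =
      PowerSeries.coeff k ((momentSeries m d p).map Complex.ofRealHom) := by
  have h := ((isTTransform_iff hdm hp.le T).1 hT).2 k hk
  have hl : (p.leadingCoeff : ℂ) ≠ 0 := by simpa using hp0
  have hm : (m.descFactorial k : ℂ) ≠ 0 := by
    rw [Ne, Nat.cast_eq_zero, Nat.descFactorial_eq_zero_iff_lt]; lia
  have hd : (d.descFactorial k : ℂ) ≠ 0 := by
    rw [Ne, Nat.cast_eq_zero, Nat.descFactorial_eq_zero_iff_lt]; lia
  rw [coeff_expectExp, PowerSeries.coeff_map, momentSeries, PowerSeries.coeff_mk, normCoeff]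
  simp only [Complex.ofRealHom_eq_coe, Complex.ofReal_mul, Complex.ofReal_pow,
    Complex.ofReal_natCast, Complex.ofReal_div, ← h]
  push_cast
  congr 1
  generalize (T.map fun t => (-t) ^ k / (k.factorial : ℂ)).sum = S
  field_simp

theorem exists_isTTransform {m d : ℕ} (hd : 0 < d) (hdm : d ≤ m) {p : Polynomial ℝ}
    (hp : p.natDegree = d) (hp0 : p ≠ 0) : ∃ T, IsTTransform m d p T := by
  have hl : (p.leadingCoeff : ℂ) ≠ 0 := by simpa using hp0
  have hd0 : (d : ℂ) ≠ 0 := Nat.cast_ne_zero.2 hd.ne'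
  -- The prescribed values solve the moment conditions for the power sums. The condition for k = 0
  -- holds by the cardinality of T.
  obtain ⟨T, hT, hs⟩ := exists_multiset_power_sums d fun k =>
    (-1) ^ k * (d * k.factorial * (p.coeff (d - k) : ℝ)) /
      (p.leadingCoeff * (m.descFactorial k * d.descFactorial k : ℂ))
  refine ⟨T, (isTTransform_iff hdm hp.le T).2 ⟨hT, fun k hk => ?_⟩⟩
  rcases Nat.eq_zero_or_pos k with rfl | hk0
  · have h : p.coeff d = p.leadingCoeff := by rw [Polynomial.leadingCoeff, hp]
    simp [hT, h, hd0]
  · have hm : (m.descFactorial k : ℂ) ≠ 0 := by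
      rw [Ne, Nat.cast_eq_zero, Nat.descFactorial_eq_zero_iff_lt]; lia
    have hd' : (d.descFactorial k : ℂ) ≠ 0 := by
      rw [Ne, Nat.cast_eq_zero, Nat.descFactorial_eq_zero_iff_lt]; lia
    have hk' : (k.factorial : ℂ) ≠ 0 := Nat.cast_ne_zero.2 k.factorial_ne_zero
    have h1 : (T.map fun t => (-t) ^ k / (k.factorial : ℂ)).sum =
        (-1) ^ k / k.factorial * (T.map fun t => t ^ k).sum := by
      rw [← Multiset.sum_map_mul_left]
      congr 2
      ext t
      rw [neg_pow]
      ring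
    have h2 : ((-1 : ℂ) ^ k) * (-1) ^ k = 1 := by rw [← mul_pow]; simp
    rw [h1, hs k hk0 hk]
    push_cast
    field_simp
    rw [pow_two, h2, one_mul]

end TTransform

/-! ### Logarithmic derivatives of power series -/

section LogDeriv

open PowerSeries

variable {K : Type*} [Field K]

/-- The logarithmic derivative `s (d/ds) log f`. -/
noncomputable def eulerLogDeriv (f : PowerSeries K) : PowerSeries K :=
  X * derivative K f * f⁻¹

theorem eulerLogDeriv_mul_self {f : PowerSeries K} (hf : constantCoeff f ≠ 0) :
    eulerLogDeriv f * f = X * derivative K f := by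
  rw [eulerLogDeriv, mul_assoc, PowerSeries.inv_mul_cancel f hf, mul_one]

theorem eq_eulerLogDeriv {f g : PowerSeries K} (hf : constantCoeff f ≠ 0)
    (h : g * f = X * derivative K f) : g = eulerLogDeriv f := by
  rw [eulerLogDeriv, ← h, mul_assoc, PowerSeries.mul_inv_cancel f hf, mul_one]

theorem eulerLogDeriv_mul {f g : PowerSeries K} (hf : constantCoeff f ≠ 0)
    (hg : constantCoeff g ≠ 0) :
    eulerLogDeriv (f * g) = eulerLogDeriv f + eulerLogDeriv g := by
  refine (eq_eulerLogDeriv (by rw [map_mul]; exact mul_ne_zero hf hg) ?_).symm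
  rw [Derivation.leibniz, smul_eq_mul, smul_eq_mul]
  linear_combination g * eulerLogDeriv_mul_self hf + f * eulerLogDeriv_mul_self hg

theorem eulerLogDeriv_map {L : Type*} [Field L] (φ : K →+* L) {f : PowerSeries K}
    (hf : constantCoeff f ≠ 0) :
    eulerLogDeriv (f.map φ) = (eulerLogDeriv f).map φ := by
  refine (eq_eulerLogDeriv ?_ ?_).symm
  · rw [← coeff_zero_eq_constantCoeff_apply, coeff_map, coeff_zero_eq_constantCoeff_apply]
    exact (map_ne_zero φ).2 hf
  · rw [← map_mul, eulerLogDeriv_mul_self hf, map_mul, map_X]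
    congr 1
    ext n
    simp [coeff_derivative]

/-- The factor X restores the order lost by differentiation. This is why information modulo s^(d+1)
suffices to compute R up to degree d. -/
theorem X_pow_dvd_X_mul_derivative {f : PowerSeries K} {n : ℕ} (h : X ^ n ∣ f) :
    X ^ n ∣ X * derivative K f := by
  rw [X_pow_dvd_iff] at h ⊢
  intro k hk
  rcases k with _ | k
  · simp
  · rw [coeff_succ_X_mul, coeff_derivative, h _ hk, zero_mul]

theorem X_pow_dvd_eulerLogDeriv_sub {f g : PowerSeries K} {n : ℕ} (hf : constantCoeff f ≠ 0)
    (hg : constantCoeff g ≠ 0) (h : X ^ n ∣ f - g) :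
    X ^ n ∣ eulerLogDeriv f - eulerLogDeriv g := by
  have h1 : eulerLogDeriv f - eulerLogDeriv g =
      (X * derivative K (f - g) * g - X * derivative K g * (f - g)) * (f⁻¹ * g⁻¹) := by
    have hf' := PowerSeries.mul_inv_cancel f hf
    have hg' := PowerSeries.mul_inv_cancel g hg
    rw [map_sub, eulerLogDeriv, eulerLogDeriv]
    linear_combination (-X * derivative K f * f⁻¹) * hg' + (X * derivative K g * g⁻¹) * hf'
  rw [h1]
  exact ((X_pow_dvd_X_mul_derivative h).mul_right _ |>.sub (h.mul_left _)).mul_right _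

theorem X_mul_derivative_logOf {K : Type*} [Field K] [Algebra ℚ K] {f : PowerSeries K}
    (hf : constantCoeff f = 1) :
    X * derivative K (logOf f) = eulerLogDeriv f := by
  have hs : HasSubst (f - 1) := HasSubst.of_constantCoeff_zero' (by simp [hf])
  -- The derivative of log(1 + X) is the alternating geometric series; substituting f - 1 for X and
  -- using the chain rule gives f'/f.
  have hgeom : derivative K (log K) * (1 + X) = 1 := by
    rw [deriv_log, mul_add, mul_one]
    ext n
    rcases n with _ | n
    · simp
    · rw [map_add, coeff_succ_mul_X, coeff_mk, coeff_mk, pow_succ]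
      simp [coeff_one]
  have h1 := congrArg (subst (f - 1)) hgeom
  rw [subst_mul hs, subst_add hs, subst_X hs] at h1
  have h2 : subst (f - 1) (1 : PowerSeries K) = (1 : PowerSeries K) := by
    rw [← coe_substAlgHom hs, map_one]
  rw [h2, add_sub_cancel] at h1
  refine eq_eulerLogDeriv (by rw [hf]; exact one_ne_zero) ?_
  rw [logOf_eq, derivative_subst hs, map_sub]
  have h3 : derivative K (1 : PowerSeries K) = 0 := Derivation.map_one_eq_zero _
  rw [h3, sub_zero]
  linear_combination X * derivative K f * h1

end LogDeriv

/-! ### The R-transform -/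

section RTransform

open Polynomial

variable {m d : ℕ}

/-- The rectangular finite `R`-transform computed from the coefficients of the polynomial. -/
noncomputable def rPoly (m d : ℕ) (p : ℝ[X]) : ℝ[X] :=
  PowerSeries.trunc (d + 1)
    (PowerSeries.C (-1 / (d : ℝ)) * eulerLogDeriv (momentSeries m d p))

theorem constantCoeff_momentSeries {p : ℝ[X]} (hp : p.natDegree = d) (hp0 : p ≠ 0) :
    PowerSeries.constantCoeff (momentSeries m d p) = 1 := by
  have h : p.coeff d = p.leadingCoeff := by rw [leadingCoeff, hp]
  rw [← PowerSeries.coeff_zero_eq_constantCoeff_apply, momentSeries, PowerSeries.coeff_mk]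
  simp [normCoeff, h, hp0]

theorem coeff_logOf_expectExp (hdm : d ≤ m) {p : ℝ[X]} (hp : p.natDegree = d) (hp0 : p ≠ 0)
    {T : Multiset ℂ} (hT : IsTTransform m d p T) {k : ℕ} (hk : k ≤ d) :
    PowerSeries.coeff k (PowerSeries.C (-1 / (d : ℂ)) * PowerSeries.X *
      PowerSeries.derivative ℂ (PowerSeries.logOf (expectExp m d T))) =
      (((rPoly m d p).coeff k : ℝ) : ℂ) := by
  have hc := constantCoeff_momentSeries (m := m) hp hp0
  have hcm : PowerSeries.constantCoeff ((momentSeries m d p).map Complex.ofRealHom) = 1 := by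
    rw [← PowerSeries.coeff_zero_eq_constantCoeff_apply, PowerSeries.coeff_map,
      PowerSeries.coeff_zero_eq_constantCoeff_apply, hc, map_one]
  have hce : PowerSeries.constantCoeff (expectExp m d T) = 1 := by
    rw [← PowerSeries.coeff_zero_eq_constantCoeff_apply,
      coeff_expectExp_of_isTTransform hdm hp hp0 hT (Nat.zero_le d),
      PowerSeries.coeff_zero_eq_constantCoeff_apply, hcm]
  have hdvd : (PowerSeries.X : PowerSeries ℂ) ^ (d + 1) ∣
      expectExp m d T - (momentSeries m d p).map Complex.ofRealHom := by
    rw [PowerSeries.X_pow_dvd_iff]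
    intro j hj
    rw [map_sub, coeff_expectExp_of_isTTransform hdm hp hp0 hT (Nat.lt_succ_iff.1 hj), sub_self]
  have h1 := X_pow_dvd_eulerLogDeriv_sub (by rw [hce]; exact one_ne_zero)
    (by rw [hcm]; exact one_ne_zero) hdvd
  rw [PowerSeries.X_pow_dvd_iff] at h1
  have h2 := sub_eq_zero.1 ((map_sub _ _ _).symm.trans (h1 k (Nat.lt_succ_of_le hk)))
  rw [mul_assoc, X_mul_derivative_logOf hce, PowerSeries.coeff_C_mul, h2,
    eulerLogDeriv_map _ (by rw [hc]; exact one_ne_zero), PowerSeries.coeff_map, rPoly,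
    PowerSeries.coeff_trunc, if_pos (Nat.lt_succ_of_le hk), PowerSeries.coeff_C_mul]
  simp

theorem rPoly_natDegree_le (p : ℝ[X]) : (rPoly m d p).natDegree ≤ d :=
  Nat.lt_succ_iff.1 (PowerSeries.natDegree_trunc_lt _ _)

/-- T may be complex and enters only through its moments of order at most d. These are real and
fixed by p, so R is real and independent of T. -/
theorem isRTransform_iff (hd : 0 < d) (hdm : d ≤ m) {p : ℝ[X]} (hp : p.natDegree = d)
    (hp0 : p ≠ 0) (R : ℝ[X]) : IsRTransform m d p R ↔ R = rPoly m d p := by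
  have hcoeff (S : ℝ[X]) (k : ℕ) : PowerSeries.coeff k
      ((S.map Complex.ofRealHom : ℂ[X]) : PowerSeries ℂ) = ((S.coeff k : ℝ) : ℂ) := by
    rw [coeff_coe, coeff_map]
    rfl
  constructor
  · rintro ⟨hR, T, hT, h⟩
    ext k
    rcases le_or_gt k d with hk | hk
    · have h1 := congrArg (fun q => q.coeff k) h
      simp only [PowerSeries.coeff_trunc, if_pos (Nat.lt_succ_of_le hk), hcoeff,
        coeff_logOf_expectExp hdm hp hp0 hT hk] at h1
      exact_mod_cast h1
    · rw [coeff_eq_zero_of_natDegree_lt (hR.trans_lt hk),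
        coeff_eq_zero_of_natDegree_lt ((rPoly_natDegree_le p).trans_lt hk)]
  · rintro rfl
    obtain ⟨T, hT⟩ := exists_isTTransform hd hdm hp hp0
    refine ⟨rPoly_natDegree_le p, T, hT, ?_⟩
    ext k
    rw [PowerSeries.coeff_trunc, PowerSeries.coeff_trunc]
    split_ifs with hk
    · rw [hcoeff, coeff_logOf_expectExp hdm hp hp0 hT (Nat.lt_succ_iff.1 hk)]
    · rfl

theorem existsUnique_isRTransform (hd : 0 < d) (hdm : d ≤ m) {p : ℝ[X]} (hp : p.natDegree = d)
    (hp0 : p ≠ 0) : ∃! R, IsRTransform m d p R :=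
  ⟨rPoly m d p, (isRTransform_iff hd hdm hp hp0 _).2 rfl,
    fun _ h => (isRTransform_iff hd hdm hp hp0 _).1 h⟩

theorem rTransform_eq_rPoly (hd : 0 < d) (hdm : d ≤ m) {p : ℝ[X]} (hp : p.natDegree = d)
    (hp0 : p ≠ 0) : rTransform m d p = rPoly m d p := by
  have h : ∃ R, IsRTransform m d p R := (existsUnique_isRTransform hd hdm hp hp0).exists
  rw [rTransform, dif_pos h]
  exact (isRTransform_iff hd hdm hp hp0 _).1 h.choose_spec

/-- The weights (md)^k are multiplicative in k, so the Cauchy product of normalized coefficients is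
a product of moment series modulo s^(d+1). -/
theorem rPoly_eq_add {p q r : ℝ[X]} (hp : p.natDegree = d) (hp0 : p ≠ 0) (hq : q.natDegree = d)
    (hq0 : q ≠ 0) (hr : r.natDegree = d) (hr0 : r ≠ 0)
    (h : ∀ k ≤ d, normCoeff m d r k = ∑ ij ∈ Finset.HasAntidiagonal.antidiagonal k,
      normCoeff m d p ij.1 * normCoeff m d q ij.2) :
    rPoly m d r = rPoly m d p + rPoly m d q := by
  have hp1 : PowerSeries.constantCoeff (momentSeries m d p) ≠ 0 := by
    rw [constantCoeff_momentSeries hp hp0]; exact one_ne_zero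
  have hq1 : PowerSeries.constantCoeff (momentSeries m d q) ≠ 0 := by
    rw [constantCoeff_momentSeries hq hq0]; exact one_ne_zero
  have hr1 : PowerSeries.constantCoeff (momentSeries m d r) ≠ 0 := by
    rw [constantCoeff_momentSeries hr hr0]; exact one_ne_zero
  have hdvd : (PowerSeries.X : PowerSeries ℝ) ^ (d + 1) ∣
      momentSeries m d r - momentSeries m d p * momentSeries m d q := by
    rw [PowerSeries.X_pow_dvd_iff]
    intro k hk
    rw [map_sub, sub_eq_zero, PowerSeries.coeff_mul]
    simp only [momentSeries, PowerSeries.coeff_mk]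
    rw [h k (Nat.lt_succ_iff.1 hk), Finset.mul_sum]
    refine Finset.sum_congr rfl fun ij hij => ?_
    rw [← Finset.HasAntidiagonal.mem_antidiagonal.1 hij, pow_add]
    ring
  have h1 := X_pow_dvd_eulerLogDeriv_sub hr1
    (by rw [map_mul]; exact mul_ne_zero hp1 hq1) hdvd
  rw [eulerLogDeriv_mul hp1 hq1, PowerSeries.X_pow_dvd_iff] at h1
  ext k
  rw [coeff_add]
  simp only [rPoly, PowerSeries.coeff_trunc]
  split_ifs with hk
  · have h2 := h1 k hk
    rw [map_sub, map_add, sub_eq_zero] at h2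
    rw [PowerSeries.coeff_C_mul, PowerSeries.coeff_C_mul, PowerSeries.coeff_C_mul, h2, mul_add]
  · rw [add_zero]

end RTransform

/-! ### Additivity -/

section Additivity

open Polynomial

variable {m d : ℕ}

theorem choose_mul_descFactorial (n i j : ℕ) :
    (n - i).choose j * n.descFactorial i * n.descFactorial j =
      n.choose j * n.descFactorial (i + j) := by
  have h := Nat.descFactorial_mul_descFactorial (n := n) (Nat.le_add_right i j)
  rw [Nat.add_sub_cancel_left] at h
  rw [← h, Nat.descFactorial_eq_factorial_mul_choose (n - i) j,
    Nat.descFactorial_eq_factorial_mul_choose n j]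
  ring

/-- By (n)_(i+j) = (n)_i (n-i)_j, each ratio (n-i choose j)/(n choose j) equals (n)_(i+j)/((n)_i
(n)_j), for n = m and n = d. -/
theorem convCoeff_div (hdm : d ≤ m) (a b : ℕ → ℝ) {k : ℕ} (hk : k ≤ d) :
    convCoeff m d a b k / (m.descFactorial k * d.descFactorial k) =
      ∑ ij ∈ Finset.HasAntidiagonal.antidiagonal k,
        a ij.1 / (m.descFactorial ij.1 * d.descFactorial ij.1) *
          (b ij.2 / (m.descFactorial ij.2 * d.descFactorial ij.2)) := by
  rw [convCoeff, Finset.sum_div]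
  refine Finset.sum_congr rfl fun ⟨i, j⟩ hij => ?_
  have hij' : i + j = k := Finset.HasAntidiagonal.mem_antidiagonal.1 hij
  subst hij'
  have hF {n l : ℕ} (h : l ≤ n) : (n.descFactorial l : ℝ) ≠ 0 := by
    rw [Ne, Nat.cast_eq_zero, Nat.descFactorial_eq_zero_iff_lt]; lia
  have hC {n l : ℕ} (h : l ≤ n) : (n.choose l : ℝ) ≠ 0 :=
    Nat.cast_ne_zero.2 (Nat.choose_pos h).ne'
  have h1 : ((m - i).choose j : ℝ) * m.descFactorial i * m.descFactorial j =
      m.choose j * m.descFactorial (i + j) := by exact_mod_cast choose_mul_descFactorial m i j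
  have h2 : ((d - i).choose j : ℝ) * d.descFactorial i * d.descFactorial j =
      d.choose j * d.descFactorial (i + j) := by exact_mod_cast choose_mul_descFactorial d i j
  have e1 : ((m - i).choose j : ℝ) = m.choose j * m.descFactorial (i + j) /
      (m.descFactorial i * m.descFactorial j) := by
    rw [eq_div_iff (mul_ne_zero (hF (by lia)) (hF (by lia))), ← h1]; ring
  have e2 : ((d - i).choose j : ℝ) = d.choose j * d.descFactorial (i + j) /
      (d.descFactorial i * d.descFactorial j) := by
    rw [eq_div_iff (mul_ne_zero (hF (by lia)) (hF (by lia))), ← h2]; ring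
  have := hF (by lia : i ≤ m)
  have := hF (by lia : j ≤ m)
  have := hF (by lia : i + j ≤ m)
  have := hF (by lia : i ≤ d)
  have := hF (by lia : j ≤ d)
  have := hF (by lia : i + j ≤ d)
  have := hC (by lia : j ≤ m)
  have := hC (by lia : j ≤ d)
  simp only
  rw [e1, e2]
  field_simp

theorem singPoly_natDegree (A : Matrix (Fin m) (Fin d) ℝ) : (singPoly A).natDegree = d := by
  rw [singPoly, charpoly_natDegree_eq_dim, Fintype.card_fin]

theorem singPoly_coeff_self (A : Matrix (Fin m) (Fin d) ℝ) : (singPoly A).coeff d = 1 := by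
  have h := (charpoly_monic (Aᵀ * A)).coeff_natDegree
  rwa [← singPoly, singPoly_natDegree] at h

theorem haarAverage_congr (hdm : d ≤ m) {A A' B B' : Matrix (Fin m) (Fin d) ℝ}
    (hA : singPoly A = singPoly A') (hB : singPoly B = singPoly B') :
    haarAverage A B = haarAverage A' B' := by
  ext k
  rcases le_or_gt k d with hk | hk
  · obtain ⟨j, hj, rfl⟩ : ∃ j ≤ d, k = d - j := ⟨d - k, by lia, by lia⟩
    rw [haarAverage_coeff hdm A B hj, haarAverage_coeff hdm A' B' hj, hA, hB]
  · rw [coeff_eq_zero_of_natDegree_lt ((haarAverage_natDegree_le A B).trans_lt hk),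
      coeff_eq_zero_of_natDegree_lt ((haarAverage_natDegree_le A' B').trans_lt hk)]

theorem Represents.singPoly_eq {A A' : Matrix (Fin m) (Fin d) ℝ} {p : ℝ[X]} (hp : p ≠ 0)
    (hA : Represents A p) (hA' : Represents A' p) : singPoly A = singPoly A' :=
  mul_left_cancel₀ (C_ne_zero.2 (leadingCoeff_ne_zero.2 hp)) (hA.symm.trans hA')

theorem HasNonnegRoots.ne_zero (hd : 0 < d) {p : ℝ[X]} (hp : HasNonnegRoots d p) : p ≠ 0 := by
  rintro rfl
  have := hp.natDegree_eq
  rw [natDegree_zero] at this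
  exact hd.ne this

theorem HasNonnegRoots.exists_represents (hdm : d ≤ m) {p : ℝ[X]} (hp : HasNonnegRoots d p) :
    ∃ A : Matrix (Fin m) (Fin d) ℝ, Represents A p := by
  have hcard : p.roots.card = d := by rw [← hp.splits.natDegree_eq_card_roots, hp.natDegree_eq]
  obtain ⟨r, hr⟩ := exists_eq_map_univ hcard
  have hr0 (j : Fin d) : 0 ≤ r j := hp.roots_nonneg _ (by rw [hr]; simp)
  -- A rectangular diagonal matrix with the square roots of the roots of p; it fits because d ≤ m.
  refine ⟨of fun i j => if i = Fin.castLE hdm j then √(r j) else 0, ?_⟩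
  have h : (of fun (i : Fin m) (j : Fin d) => if i = Fin.castLE hdm j then √(r j) else 0)ᵀ *
      (of fun (i : Fin m) (j : Fin d) => if i = Fin.castLE hdm j then √(r j) else 0) =
      diagonal r := by
    ext i j
    rw [mul_apply, Finset.sum_eq_single_of_mem (Fin.castLE hdm i) (Finset.mem_univ _)]
    · by_cases hij : i = j
      · subst hij
        simp [Real.mul_self_sqrt (hr0 i)]
      · simp [hij]
    · intro x _ hx
      simp [hx]
  rw [Represents, singPoly, h, charpoly_diagonal]
  conv_lhs => rw [hp.splits.eq_prod_roots, hr, Multiset.map_map]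
  rfl

theorem rectConv_eq (hdm : d ≤ m) {p q : ℝ[X]} (hp : p ≠ 0) (hq : q ≠ 0)
    {A B : Matrix (Fin m) (Fin d) ℝ} (hA : Represents A p) (hB : Represents B q) :
    rectConv m d p q = C (p.leadingCoeff * q.leadingCoeff) * haarAverage A B := by
  have h : (∃ A : Matrix (Fin m) (Fin d) ℝ, Represents A p) ∧
      (∃ B : Matrix (Fin m) (Fin d) ℝ, Represents B q) := ⟨⟨A, hA⟩, ⟨B, hB⟩⟩
  rw [rectConv, dif_pos h, haarAverage_congr hdm (h.1.choose_spec.singPoly_eq hp hA)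
    (h.2.choose_spec.singPoly_eq hq hB)]

theorem haarAverage_monic_natDegree (hdm : d ≤ m) (A B : Matrix (Fin m) (Fin d) ℝ) :
    (haarAverage A B).Monic ∧ (haarAverage A B).natDegree = d := by
  have h := haarAverage_coeff hdm A B (Nat.zero_le d)
  -- For k = 0 the formula reduces to a_0 b_0 = 1.
  simp [convCoeff, singPoly_coeff_self] at h
  have hn : (haarAverage A B).natDegree = d :=
    le_antisymm (haarAverage_natDegree_le A B)
      (le_natDegree_of_ne_zero (by rw [h]; exact one_ne_zero))
  exact ⟨by rw [Monic, leadingCoeff, hn, h], hn⟩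

theorem normCoeff_C_mul {c : ℝ} (hc : c ≠ 0) {f : ℝ[X]} (hf : f.Monic) (k : ℕ) :
    normCoeff m d (C c * f) k = f.coeff (d - k) / (m.descFactorial k * d.descFactorial k) := by
  rw [normCoeff, coeff_C_mul, leadingCoeff_C_mul_of_isUnit (IsUnit.mk0 c hc), hf.leadingCoeff,
    mul_one, mul_div_mul_left _ _ hc]

end Additivity

end RectFree

theorem mainTheorem1 (m d : ℕ) (hd : 0 < d) (hdm : d ≤ m) (p q : Polynomial ℝ)
    (hp : RectFree.HasNonnegRoots d p) (hq : RectFree.HasNonnegRoots d q) :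
    -- the convolution does not depend on the choice of the representing matrices
    (∀ A B : Matrix (Fin m) (Fin d) ℝ, RectFree.Represents A p → RectFree.Represents B q →
      RectFree.rectConv m d p q =
        Polynomial.C (p.leadingCoeff * q.leadingCoeff) * RectFree.haarAverage A B) ∧
    -- the three transforms exist and are unique
    (∃! R, RectFree.IsRTransform m d p R) ∧
    (∃! R, RectFree.IsRTransform m d q R) ∧
    (∃! R, RectFree.IsRTransform m d (RectFree.rectConv m d p q) R) ∧
    -- additivity
    RectFree.rTransform m d (RectFree.rectConv m d p q) =
      RectFree.rTransform m d p + RectFree.rTransform m d q := by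
  have hp0 := hp.ne_zero hd
  have hq0 := hq.ne_zero hd
  obtain ⟨A, hA⟩ := hp.exists_represents hdm
  obtain ⟨B, hB⟩ := hq.exists_represents hdm
  have hlp := Polynomial.leadingCoeff_ne_zero.2 hp0
  have hlq := Polynomial.leadingCoeff_ne_zero.2 hq0
  have hr := RectFree.rectConv_eq hdm hp0 hq0 hA hB
  obtain ⟨hmonic, hdeg⟩ := RectFree.haarAverage_monic_natDegree hdm A B
  have hrdeg : (RectFree.rectConv m d p q).natDegree = d := by
    rw [hr, Polynomial.natDegree_C_mul (mul_ne_zero hlp hlq), hdeg]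
  have hr0 : RectFree.rectConv m d p q ≠ 0 := by
    rw [hr]
    exact mul_ne_zero (Polynomial.C_ne_zero.2 (mul_ne_zero hlp hlq)) hmonic.ne_zero
  refine ⟨fun A B hA hB => RectFree.rectConv_eq hdm hp0 hq0 hA hB,
    RectFree.existsUnique_isRTransform hd hdm hp.natDegree_eq hp0,
    RectFree.existsUnique_isRTransform hd hdm hq.natDegree_eq hq0,
    RectFree.existsUnique_isRTransform hd hdm hrdeg hr0, ?_⟩
  rw [RectFree.rTransform_eq_rPoly hd hdm hp.natDegree_eq hp0,
    RectFree.rTransform_eq_rPoly hd hdm hq.natDegree_eq hq0,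
    RectFree.rTransform_eq_rPoly hd hdm hrdeg hr0]
  refine RectFree.rPoly_eq_add hp.natDegree_eq hp0 hq.natDegree_eq hq0 hrdeg hr0 fun k hk => ?_
  -- Leading coefficients cancel in `normCoeff`, so the claim reduces to the monic polynomials
  -- `singPoly A`, `singPoly B` and their Haar average.
  have hnp (i : ℕ) := RectFree.normCoeff_C_mul (m := m) (d := d) hlp
    (Matrix.charpoly_monic (A.transpose * A)) i
  have hnq (i : ℕ) := RectFree.normCoeff_C_mul (m := m) (d := d) hlq
    (Matrix.charpoly_monic (B.transpose * B)) i
  rw [← RectFree.singPoly, ← hA] at hnp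
  rw [← RectFree.singPoly, ← hB] at hnq
  rw [hr, RectFree.normCoeff_C_mul (mul_ne_zero hlp hlq) hmonic,
    RectFree.haarAverage_coeff hdm A B hk, RectFree.convCoeff_div hdm _ _ hk]
  simp only [hnp, hnq]
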